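/- Let $d\ge 1$ and let $h:\mathbb{R}^d\to\{\text{subsets of }\mathbb{R}^d\}$. On a probability space consider random vectors in $\mathbb{R}^d$ with $$x_{n+1}=x_n+a(n)\,[\,y_n+M_{n+1}\,],\qquad y_n\in h(x_n),\qquad n\ge 0 .$$ Definitions. A solution of $\dot x\in H(x)$ is a locally absolutely continuous map $\mathbf{x}:[0,\infty)\to\mathbb{R}^d$ with $\dot{\mathbf{x}}(t)\in H(\mathbf{x}(t))$ for almost every $t$. A compact set $A$ is an attracting set with fundamental neighborhood $U$ if $U$ is a neighborhood of $A$ and for every $\epsilon>0$ there is $T(\epsilon)\ge 0$ such that $\mathbf{x}(t)\in N^{\epsilon}(A)=\{z: d(z,A)<\epsilon\}$ for every solution $\mathbf{x}$ with $\mathbf{x}(0)\in U$ and every $t\ge T(\epsilon)$. A set $S$ is invariant if for every $x\in S$ there is a solution $\mathbf{x}$ with $\mathbf{x}(0)=x$ and $\mathbf{x}(t)\in S$ for all $t\ge 0$. A set $S$ is internally chain transitive if it is compact and for all $x,y\in S$, $\epsilon>0$, $T>0$ there are $n\ge 1$, points $x_1=x,\dots,x_{n+1}=y$ in $S$, solutions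 $\Phi^1,\dots,\Phi^n$ and reals $t_1,\dots,t_n>T$ such that, for $1\le i\le n$, $\Phi^i(0)=x_i$, $\Phi^i([0,t_i])\subset S$ and $\|\Phi^i(t_i)-x_{i+1}\|<\epsilon$. For real $c\ge 1$ put $h_c(x)=\{y: cy\in h(cx)\}$, and let $$h_\infty(x)=\overline{\{y:\ \lim_{c\to\infty} d(y,h_c(x))=0\}},\qquad d(y,\emptyset)=\infty .$$ Assume: (A1) $h$ is a Marchaud map: every $h(x)$ is convex and compact, there is $K>0$ with $\|w\|<K(1+\|x\|)$ for all $x$ and all $w\in h(x)$, and the graph of $h$ is closed. (A2) $a(n)>0$ for all $n$, $\sum_n a(n)=\infty$ and $\sum_n a(n)^2<\infty$. (A3) $\{M_n\}_{n\ge1}$ is a square-integrable martingale difference sequence with respect to $\mathcal{F}_n=\sigma(x_0,M_1,\dots,M_n)$, and for some $K>0$, almost surely $E[\|M_{n+1}\|^2\mid\mathcal{F}_n]\le K(1+\|x_n\|^2)$ for all $n\ge 0$. (A4) $h_\infty(x)\ne\emptyset$ for all $x$, and $\dot x\in h_\infty(x)$ has an attracting set $\mathcal{A}\subseteq B_1(0)$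 (the open unit ball) with a fundamental neighborhood that contains the closed unit ball $\overline{B}_1(0)$. (A5) If $c_n\ge1$ are integers with $c_n\uparrow\infty$, $x_n\to x$, $y_n\to y$ and $y_n\in h_{c_n}(x_n)$ for all $n$, then $y\in h_\infty(x)$. Then, almost surely, the sequence $\{x_n\}_{n\ge0}$ is bounded and there is a (sample path dependent) nonempty closed, connected, internally chain transitive and invariant set $S$ of $\dot x\in h(x)$ such that $d(x_n,S)\to0$ as $n\to\infty$. -/

import Mathlib

open MeasureTheory Filter Topology

namespace SRI

/-- The state space `ℝ^d` with its Euclidean norm. -/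
abbrev State (d : ℕ) : Type := EuclideanSpace ℝ (Fin d)

/-- A Marchaud map: convex compact values, linear growth and closed graph. -/
structure IsMarchaud {d : ℕ} (h : State d → Set (State d)) : Prop where
  convex : ∀ x, Convex ℝ (h x)
  compact : ∀ x, IsCompact (h x)
  growth : ∃ K : ℝ, 0 < K ∧ ∀ x, ∀ w ∈ h x, ‖w‖ < K * (1 + ‖x‖)
  closed_graph : IsClosed {p : State d × State d | p.2 ∈ h p.1}

/-- `x`, restricted to `[0, ∞)`, is a (locally) absolutely continuous solution of `ẋ ∈ H(x)`. -/
structure IsSolution {d : ℕ} (H : State d → Set (State d)) (x : ℝ → State d) : Prop where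
  absCont : ∀ T : ℝ, 0 ≤ T → AbsolutelyContinuousOnInterval x 0 T
  inclusion : ∀ᵐ t ∂(volume.restrict (Set.Ioi (0 : ℝ))), ∃ v ∈ H (x t), HasDerivAt x v t

/-- The set-valued semiflow `Φ_t(x)` of `ẋ ∈ H(x)`. -/
def flow {d : ℕ} (H : State d → Set (State d)) (t : ℝ) (x : State d) : Set (State d) :=
  {z | ∃ φ : ℝ → State d, IsSolution H φ ∧ φ 0 = x ∧ φ t = z}

/-- `Φ_B(M)`, the union of `Φ_t(x)` over `t ∈ B` and `x ∈ M`. -/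
def flowImage {d : ℕ} (H : State d → Set (State d)) (B : Set ℝ) (M : Set (State d)) :
    Set (State d) :=
  ⋃ t ∈ B, ⋃ x ∈ M, flow H t x

/-- `A` is an attracting set of `ẋ ∈ H(x)` with fundamental neighborhood `U`. -/
structure IsAttractingSet {d : ℕ} (H : State d → Set (State d)) (A U : Set (State d)) :
    Prop where
  compact : IsCompact A
  nhds : U ∈ 𝓝ˢ A
  attracts : ∀ ε : ℝ, 0 < ε → ∃ T : ℝ, 0 ≤ T ∧
    flowImage H (Set.Ici T) U ⊆ Metric.thickening ε A

/-- Invariance: through every point of `M` there is a solution on `[0, ∞)` staying in `M`. -/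
def IsInvariant {d : ℕ} (H : State d → Set (State d)) (M : Set (State d)) : Prop :=
  ∀ x ∈ M, ∃ φ : ℝ → State d, IsSolution H φ ∧ φ 0 = x ∧ ∀ t : ℝ, 0 ≤ t → φ t ∈ M

/-- An `(ε, T)` chain in `M` from `x` to `y`; it has `n + 1 ≥ 1` pieces. The points of the chain
are `p 0 = x, …, p (n + 1) = y`. -/
def HasChain {d : ℕ} (H : State d → Set (State d)) (M : Set (State d)) (ε T : ℝ)
    (x y : State d) : Prop :=
  ∃ (n : ℕ) (p : Fin (n + 2) → State d) (φ : Fin (n + 1) → ℝ → State d) (t : Fin (n + 1) → ℝ),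
    p 0 = x ∧ p (Fin.last (n + 1)) = y ∧ (∀ i, p i ∈ M) ∧
    ∀ i : Fin (n + 1), IsSolution H (φ i) ∧ φ i 0 = p i.castSucc ∧ T < t i ∧
      (∀ s ∈ Set.Icc 0 (t i), φ i s ∈ M) ∧ dist (φ i (t i)) (p i.succ) < ε

/-- Internally chain transitive sets of `ẋ ∈ H(x)`. -/
def IsInternallyChainTransitive {d : ℕ} (H : State d → Set (State d)) (M : Set (State d)) :
    Prop :=
  IsCompact M ∧ ∀ x ∈ M, ∀ y ∈ M, ∀ ε : ℝ, 0 < ε → ∀ T : ℝ, 0 < T → HasChain H M ε T x y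

/-- The rescaled map `h_c(x) = {y | c y ∈ h(c x)}`. -/
def rescale {d : ℕ} (h : State d → Set (State d)) (c : ℝ) (x : State d) : Set (State d) :=
  {y | c • y ∈ h (c • x)}

/-- The lower limit, as the real parameter `c` tends to infinity, of a family of sets. The distance
to the empty set is `∞`. -/
def lowerLimit {d : ℕ} (K : ℝ → Set (State d)) : Set (State d) :=
  {y | Tendsto (fun c : ℝ => Metric.infEDist y (K c)) atTop (𝓝 0)}

/-- `h_∞(x)`, the closure of the lower limit of `h_c(x)` as `c → ∞`. -/
def hInf {d : ℕ} (h : State d → Set (State d)) (x : State d) : Set (State d) :=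
  closure (lowerLimit fun c => rescale h c x)

/-- The σ-algebra `σ(x₀, M₁, …, M_n)`. -/
@[reducible] def noiseSigma {Ω : Type*} {d : ℕ} (x₀ : Ω → State d) (M : ℕ → Ω → State d) (n : ℕ) :
    MeasurableSpace Ω :=
  MeasurableSpace.comap x₀ inferInstance ⊔
    ⨆ k ∈ Finset.Icc 1 n, MeasurableSpace.comap (M k) inferInstance

/-- The step sizes are positive, with divergent sum and convergent sum of squares. -/
structure StepSizes (a : ℕ → ℝ) : Prop where
  pos : ∀ n, 0 < a n
  sum_diverges : Tendsto (fun n => ∑ i ∈ Finset.range n, a i) atTop atTop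
  sq_summable : Summable fun n => a n ^ 2

/-- `M₁, M₂, …` is a square integrable martingale difference sequence for `σ(x₀, M₁, …, M_n)`
whose conditional second moments are bounded by `K (1 + ‖x_n‖²)`. (`M 0` plays no role.) -/
structure MartingaleNoise {Ω : Type*} [MeasurableSpace Ω] {d : ℕ} (μ : Measure Ω)
    (x M : ℕ → Ω → State d) : Prop where
  measurable_init : Measurable (x 0)
  measurable_noise : ∀ n, Measurable (M (n + 1))
  sq_integrable : ∀ n, MemLp (M (n + 1)) 2 μ
  mds : ∀ n, μ[M (n + 1) | noiseSigma (x 0) M n] =ᵐ[μ] 0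
  cond_sq_le : ∃ K : ℝ, 0 < K ∧ ∀ n,
    μ[fun ω => ‖M (n + 1) ω‖ ^ 2 | noiseSigma (x 0) M n]
      ≤ᵐ[μ] fun ω => K * (1 + ‖x n ω‖ ^ 2)

/-- `h_∞` has nonempty values, and `ẋ ∈ h_∞(x)` has an attracting set inside the open unit ball
with a fundamental neighborhood that contains the closed unit ball. -/
structure InfinityAttracting {d : ℕ} (h : State d → Set (State d)) : Prop where
  nonempty : ∀ x, (hInf h x).Nonempty
  attracting : ∃ A U : Set (State d), IsAttractingSet (hInf h) A U ∧
    Metric.closedBall 0 1 ⊆ U ∧ A ⊆ Metric.ball 0 1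

/-- Limits of `y_n ∈ h_{c_n}(x_n)` along integers `c_n ↑ ∞` lie in `h_∞`. -/
def InfinityClosed {d : ℕ} (h : State d → Set (State d)) : Prop :=
  ∀ (c : ℕ → ℕ) (u v : ℕ → State d) (x y : State d),
    StrictMono c → (∀ n, 1 ≤ c n) → Tendsto u atTop (𝓝 x) → Tendsto v atTop (𝓝 y) →
    (∀ n, v n ∈ rescale h (c n : ℝ) (u n)) → y ∈ hInf h x

end SRI

/-! Seen from late iterates, with sums of step sizes as the clock, the path is a noisy Euler scheme.
If the noise is negligible on bounded time windows, limits of its shifts solve a differential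
inclusion: `h` at unit scale, `hInf h` when the path is divided by scales tending to infinity. The
second limit gives boundedness, the first describes the limit set.

The obstacle is that the variance bound involves `‖x n‖`, which is not yet known to be bounded, so
the weighted noise cannot be summed outright. It is instead cut off at each dyadic scale `2 ^ j` by
its conditional variance and divided by that scale. Summed over all scales, the variances at step
`k` are at most `2 * a k ^ 2`, and the `L²` maximal inequality controls every scale at once. The
outcome, `NoiseNegligible`, bounds the noise by `ε * R` for all radii `R` simultaneously; from there
on everything is deterministic.

A discrete Gronwall argument (`eventually_norm_le`) bounds growth over a window by a constant
factor. Rescaled shifts are then asymptotically Lipschitz, and `exists_limit_solution` takes limits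
along an ultrafilter: difference quotients are convex combinations of field values up to noise, so
upper semicontinuity and convexity put the derivative of the limit in the limiting field.

If the path failed to move inwards from ever larger iterates, a rescaled limit would start in the
closed unit ball and end outside the open one, contradicting the contraction supplied by the
attracting set. Once the path is bounded, `S` is its limit set: shadowing of late pieces by
solutions inside it gives invariance, convergence and chains, and chain transitivity forces
connectedness. -/

namespace SRI

/-! ### Square integrable martingale differences -/

section Probability

variable {Ω E : Type*} {mΩ : MeasurableSpace Ω} {μ : Measure Ω}
  [NormedAddCommGroup E] [InnerProductSpace ℝ E]

/-- A square integrable martingale difference sequence: `D k` is known at time `k + 1`. -/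
structure IsL2Difference (F : Filtration ℕ mΩ) (μ : Measure Ω) (D : ℕ → Ω → E) : Prop where
  meas : ∀ k, StronglyMeasurable[F (k + 1)] (D k)
  memLp : ∀ k, MemLp (D k) 2 μ
  condExp_eq_zero : ∀ k, μ[D k | F k] =ᵐ[μ] 0

namespace IsL2Difference

variable {F : Filtration ℕ mΩ} {D : ℕ → Ω → E}

lemma stronglyMeasurable_sum (hD : IsL2Difference F μ D) (n : ℕ) :
    StronglyMeasurable[F n] (fun ω => ∑ k ∈ Finset.range n, D k ω) := by
  refine Finset.stronglyMeasurable_fun_sum _ fun k hk => ?_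
  exact (hD.meas k).mono (F.mono (Finset.mem_range.1 hk))

lemma memLp_sum (hD : IsL2Difference F μ D) (n : ℕ) :
    MemLp (fun ω => ∑ k ∈ Finset.range n, D k ω) 2 μ :=
  memLp_finsetSum _ fun k _ => hD.memLp k

lemma integrable_inner (hD : IsL2Difference F μ D) (n : ℕ) :
    Integrable (fun ω => inner ℝ (∑ k ∈ Finset.range n, D k ω) (D n ω)) μ :=
  ((hD.memLp_sum n).norm.integrable_mul (hD.memLp n).norm).mono'
    ((hD.memLp_sum n).aestronglyMeasurable.inner (hD.memLp n).aestronglyMeasurable)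
    (ae_of_all _ fun _ => norm_inner_le_norm _ _)

lemma norm_sq_sum_succ (n : ℕ) (ω : Ω) :
    ‖∑ k ∈ Finset.range (n + 1), D k ω‖ ^ 2 = ‖∑ k ∈ Finset.range n, D k ω‖ ^ 2
      + (2 * inner ℝ (∑ k ∈ Finset.range n, D k ω) (D n ω) + ‖D n ω‖ ^ 2) := by
  rw [Finset.sum_range_succ, norm_add_sq_real]; ring

lemma integrable_norm_sq_sum (hD : IsL2Difference F μ D) (n : ℕ) :
    Integrable (fun ω => ‖∑ k ∈ Finset.range n, D k ω‖ ^ 2) μ :=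
  (hD.memLp_sum n).integrable_norm_pow (by norm_num)

lemma integrable_norm_sq (hD : IsL2Difference F μ D) (n : ℕ) :
    Integrable (fun ω => ‖D n ω‖ ^ 2) μ :=
  (hD.memLp n).integrable_norm_pow (by norm_num)

/-- The filtration that starts at time `m`. -/
def shiftFiltration (F : Filtration ℕ mΩ) (m : ℕ) : Filtration ℕ mΩ where
  seq k := F (m + k)
  mono' _ _ hij := F.mono (Nat.add_le_add_left hij m)
  le' k := F.le (m + k)

lemma shift (hD : IsL2Difference F μ D) (m : ℕ) :
    IsL2Difference (shiftFiltration F m) μ (fun k => D (m + k)) where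
  meas k := hD.meas (m + k)
  memLp k := hD.memLp (m + k)
  condExp_eq_zero k := hD.condExp_eq_zero (m + k)

variable [IsProbabilityMeasure μ] [CompleteSpace E]

/-- The partial sum is known at time `n` and can be pulled out of the conditional expectation. This
orthogonality removes the cross terms both in the variance identity and in the submartingale
property. -/
lemma condExp_inner (hD : IsL2Difference F μ D) (n : ℕ) :
    μ[fun ω => inner ℝ (∑ k ∈ Finset.range n, D k ω) (D n ω) | F n] =ᵐ[μ] 0 := by
  have h := condExp_bilin_of_stronglyMeasurable_left (m := F n) (μ := μ) (innerSL ℝ (E := E))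
    (hD.stronglyMeasurable_sum n) (g := D n) (hD.integrable_inner n)
    ((hD.memLp n).integrable one_le_two)
  filter_upwards [h, hD.condExp_eq_zero n] with ω h1 h2
  rw [Pi.zero_apply] at h2 ⊢
  exact h1.trans (by rw [h2, map_zero])

lemma integral_norm_sq_sum (hD : IsL2Difference F μ D) (n : ℕ) :
    ∫ ω, ‖∑ k ∈ Finset.range n, D k ω‖ ^ 2 ∂μ = ∑ k ∈ Finset.range n, ∫ ω, ‖D k ω‖ ^ 2 ∂μ := by
  induction n with
  | zero => simp
  | succ n ih =>
    have h0 : ∫ ω, inner ℝ (∑ k ∈ Finset.range n, D k ω) (D n ω) ∂μ = 0 := by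
      rw [← integral_condExp (F.le n), integral_congr_ae (hD.condExp_inner n)]
      simp
    simp_rw [norm_sq_sum_succ]
    have h1 : Integrable (fun ω => 2 * inner ℝ (∑ k ∈ Finset.range n, D k ω) (D n ω)
        + ‖D n ω‖ ^ 2) μ := ((hD.integrable_inner n).const_mul 2).add (hD.integrable_norm_sq n)
    rw [integral_add (hD.integrable_norm_sq_sum n) h1,
      integral_add ((hD.integrable_inner n).const_mul 2) (hD.integrable_norm_sq n),
      integral_const_mul, h0, ih, Finset.sum_range_succ]
    ring

lemma submartingale_norm_sq_sum (hD : IsL2Difference F μ D) :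
    Submartingale (fun n ω => ‖∑ k ∈ Finset.range n, D k ω‖ ^ 2) F μ := by
  refine submartingale_of_condExp_sub_nonneg_nat
    (fun n => ((hD.stronglyMeasurable_sum n).norm.pow 2)) hD.integrable_norm_sq_sum fun n => ?_
  have hfun : (fun ω => ‖∑ k ∈ Finset.range (n + 1), D k ω‖ ^ 2)
      - (fun ω => ‖∑ k ∈ Finset.range n, D k ω‖ ^ 2)
      = (2 : ℝ) • (fun ω => inner ℝ (∑ k ∈ Finset.range n, D k ω) (D n ω))
        + fun ω => ‖D n ω‖ ^ 2 := by
    funext ω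
    simp only [Pi.sub_apply, Pi.add_apply, Pi.smul_apply, smul_eq_mul, norm_sq_sum_succ]
    ring
  rw [hfun]
  have h1 := condExp_add (μ := μ) ((hD.integrable_inner n).smul (2 : ℝ))
    (hD.integrable_norm_sq n) (F n)
  have h2 := condExp_smul (μ := μ) (2 : ℝ)
    (fun ω => inner ℝ (∑ k ∈ Finset.range n, D k ω) (D n ω)) (F n)
  have h3 : 0 ≤ᵐ[μ] μ[fun ω => ‖D n ω‖ ^ 2 | F n] :=
    condExp_nonneg (ae_of_all _ fun ω => by positivity)
  filter_upwards [h1, h2, h3, hD.condExp_inner n] with ω h1 h2 h3 h4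
  rw [h1, Pi.add_apply, h2, Pi.smul_apply, h4]
  simpa using h3

/-- The `L²` maximal inequality for the partial sums. -/
theorem measure_exists_le_norm_sum (hD : IsL2Difference F μ D) {ε : ℝ} (hε : 0 < ε) :
    ENNReal.ofReal (ε ^ 2) * μ {ω | ∃ n, ε ≤ ‖∑ k ∈ Finset.range n, D k ω‖}
      ≤ ∑' k, ENNReal.ofReal (∫ ω, ‖D k ω‖ ^ 2 ∂μ) := by
  set A : ℕ → Set Ω := fun N => {ω | ∃ n ≤ N, ε ≤ ‖∑ k ∈ Finset.range n, D k ω‖} with hA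
  have hunion : {ω | ∃ n, ε ≤ ‖∑ k ∈ Finset.range n, D k ω‖} = ⋃ N, A N := by
    ext ω
    simp only [hA, Set.mem_ofPred_eq, Set.mem_iUnion]
    exact ⟨fun ⟨n, hn⟩ => ⟨n, n, le_rfl, hn⟩, fun ⟨_, n, _, hn⟩ => ⟨n, hn⟩⟩
  have hmono : Monotone A := fun N N' hN ω ⟨n, hn, h⟩ => ⟨n, hn.trans hN, h⟩
  rw [hunion, hmono.measure_iUnion, ENNReal.mul_iSup]
  refine iSup_le fun N => ?_
  obtain ⟨e, he⟩ : ∃ e : NNReal, (e : ℝ) = ε ^ 2 := ⟨⟨ε ^ 2, by positivity⟩, rfl⟩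
  have hmax := maximal_ineq hD.submartingale_norm_sq_sum
    (fun n ω => by positivity) (ε := e) N
  have hset : {ω | (e : ℝ) ≤
      (Finset.range (N + 1)).sup' Finset.nonempty_range_add_one
        fun k => ‖∑ i ∈ Finset.range k, D i ω‖ ^ 2} = A N := by
    ext ω
    simp only [hA, Set.mem_ofPred_eq, Finset.le_sup'_iff, Finset.mem_range, Nat.lt_succ_iff, he]
    refine exists_congr fun n => and_congr_right fun _ => ?_
    exact pow_le_pow_iff_left₀ hε.le (norm_nonneg _) two_ne_zero
  rw [hset] at hmax
  calc ENNReal.ofReal (ε ^ 2) * μ (A N)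
      ≤ ENNReal.ofReal (∫ ω in A N, ‖∑ k ∈ Finset.range N, D k ω‖ ^ 2 ∂μ) := by
        rw [← he, ENNReal.ofReal_coe_nnreal]; exact hmax
    _ ≤ ENNReal.ofReal (∫ ω, ‖∑ k ∈ Finset.range N, D k ω‖ ^ 2 ∂μ) :=
        ENNReal.ofReal_le_ofReal (setIntegral_le_integral (hD.integrable_norm_sq_sum N)
          (ae_of_all _ fun ω => by positivity))
    _ = ∑ k ∈ Finset.range N, ENNReal.ofReal (∫ ω, ‖D k ω‖ ^ 2 ∂μ) := by
        rw [hD.integral_norm_sq_sum, ENNReal.ofReal_sum_of_nonneg]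
        exact fun k _ => integral_nonneg fun ω => by positivity
    _ ≤ _ := ENNReal.sum_le_tsum _

end IsL2Difference

/-- A family of martingale difference sequences with summable total variance is almost surely
Cauchy, uniformly over the family. -/
theorem ae_uniform_cauchy [IsProbabilityMeasure μ] [CompleteSpace E] {F : Filtration ℕ mΩ} {D : ℕ → ℕ → Ω → E}
    (hD : ∀ j, IsL2Difference F μ (D j)) {b : ℕ → ℝ} (hb : Summable b)
    (hDb : ∀ k, ∑' j, ENNReal.ofReal (∫ ω, ‖D j k ω‖ ^ 2 ∂μ) ≤ ENNReal.ofReal (b k)) :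
    ∀ᵐ ω ∂μ, ∀ ε : ℝ, 0 < ε → ∃ m, ∀ n, m ≤ n → ∀ n', n ≤ n' → ∀ j,
      ‖∑ k ∈ Finset.Ico n n', D j k ω‖ ≤ ε := by
  have key : ∀ ε : ℝ, 0 < ε → ∀ᵐ ω ∂μ, ∃ m, ∀ j n,
      ‖∑ k ∈ Finset.range n, D j (m + k) ω‖ < ε := by
    intro ε hε
    set B : ℕ → Set Ω := fun m => {ω | ∃ j n, ε ≤ ‖∑ k ∈ Finset.range n, D j (m + k) ω‖} with hB
    have hc0 : ENNReal.ofReal (ε ^ 2) ≠ 0 := by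
      rw [Ne, ENNReal.ofReal_eq_zero, not_le]; positivity
    have hbound : ∀ m, ENNReal.ofReal (ε ^ 2) * μ (B m) ≤ ∑' k, ENNReal.ofReal (b (k + m)) := by
      intro m
      have hBu : B m = ⋃ j, {ω | ∃ n, ε ≤ ‖∑ k ∈ Finset.range n, D j (m + k) ω‖} := by
        ext ω; simp [hB]
      calc ENNReal.ofReal (ε ^ 2) * μ (B m)
          ≤ ENNReal.ofReal (ε ^ 2) *
            ∑' j, μ {ω | ∃ n, ε ≤ ‖∑ k ∈ Finset.range n, D j (m + k) ω‖} := by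
            gcongr; rw [hBu]; exact measure_iUnion_le _
        _ = ∑' j, ENNReal.ofReal (ε ^ 2) *
            μ {ω | ∃ n, ε ≤ ‖∑ k ∈ Finset.range n, D j (m + k) ω‖} := ENNReal.tsum_mul_left.symm
        _ ≤ ∑' j, ∑' k, ENNReal.ofReal (∫ ω, ‖D j (m + k) ω‖ ^ 2 ∂μ) :=
            ENNReal.tsum_le_tsum fun j => ((hD j).shift m).measure_exists_le_norm_sum hε
        _ = ∑' k, ∑' j, ENNReal.ofReal (∫ ω, ‖D j (m + k) ω‖ ^ 2 ∂μ) := ENNReal.tsum_comm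
        _ ≤ _ := ENNReal.tsum_le_tsum fun k => by rw [add_comm k m]; exact hDb (m + k)
    have htail : Tendsto (fun m => ∑' k, ENNReal.ofReal (b (k + m))) atTop (𝓝 0) :=
      ENNReal.tendsto_sum_nat_add _ hb.tsum_ofReal_ne_top
    -- The intersection is contained in each `B m`, so its measure is controlled by every tail of
    -- the convergent series.
    have hnull : μ (⋂ m, B m) = 0 := by
      have hle : ∀ m, ENNReal.ofReal (ε ^ 2) * μ (⋂ m, B m) ≤ ∑' k, ENNReal.ofReal (b (k + m)) :=
        fun m => (mul_le_mul_right (measure_mono (Set.iInter_subset _ m)) _).trans (hbound m)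
      have := ge_of_tendsto' htail hle
      simpa [hc0] using this
    rw [ae_iff]
    convert hnull using 2
    ext ω
    simp [hB]
  have hall : ∀ᵐ ω ∂μ, ∀ i : ℕ, ∃ m, ∀ j n,
      ‖∑ k ∈ Finset.range n, D j (m + k) ω‖ < 1 / ((i : ℝ) + 1) :=
    ae_all_iff.2 fun i => key _ (by positivity)
  filter_upwards [hall] with ω hω ε hε
  obtain ⟨i, hi⟩ := exists_nat_one_div_lt (half_pos hε)
  obtain ⟨m, hm⟩ := hω i
  refine ⟨m, fun n hn n' hn' j => ?_⟩
  have hsum : ∀ p, m ≤ p → ‖∑ k ∈ Finset.Ico m p, D j k ω‖ < ε / 2 := by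
    intro p hp
    rw [Finset.sum_Ico_eq_sum_range]
    exact (hm j (p - m)).trans hi
  rw [eq_sub_of_add_eq' (Finset.sum_Ico_consecutive (fun k => D j k ω) hn hn')]
  exact (norm_sub_le _ _).trans (by linarith [hsum n hn, hsum n' (hn.trans hn')])

end Probability

/-! ### Noise control at all scales -/

/-- The weighted noise accumulated while the path stays in the ball of radius `R ≥ 1` is
eventually at most `ε R`, uniformly in `R`. -/
def NoiseNegligible {E : Type*} [NormedAddCommGroup E] [NormedSpace ℝ E]
    (a : ℕ → ℝ) (x m : ℕ → E) : Prop :=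
  ∀ ε : ℝ, 0 < ε → ∃ N, ∀ n, N ≤ n → ∀ n', n ≤ n' → ∀ R : ℝ, 1 ≤ R →
    (∀ k, n ≤ k → k < n' → ‖x k‖ ≤ R) → ‖∑ k ∈ Finset.Ico n n', a k • m (k + 1)‖ ≤ ε * R

/-- The nonzero terms form a geometric progression of ratio `1 / 4` whose first term is at most `1`,
unless the progression begins at `j = 0`, where the cut-off again gives at most `1`. The total never
exceeds `4 / 3`. -/
lemma sum_truncated_le {V : ℝ} (hV : 0 ≤ V) (J : ℕ) :
    ∑ j ∈ Finset.range J, (if V ≤ 4 ^ j then V / 4 ^ j else 0) ≤ 2 := by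
  -- The added term is the whole remaining tail of the geometric series once the cut-off has been
  -- passed, so it makes the induction exact.
  suffices h : ∑ j ∈ Finset.range J, (if V ≤ 4 ^ j then V / 4 ^ j else 0)
      + (if V ≤ 4 ^ J then 4 / 3 * (V / 4 ^ J) else 0) ≤ 2 by
    refine le_trans (le_add_of_nonneg_right ?_) h
    split_ifs <;> positivity
  induction J with
  | zero =>
    simp only [Finset.range_zero, Finset.sum_empty, pow_zero, zero_add, div_one]
    split_ifs <;> linarith
  | succ J ih =>
    rw [Finset.sum_range_succ]
    by_cases hJ : V ≤ 4 ^ J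
    · have hJ' : V ≤ 4 ^ (J + 1) := hJ.trans (pow_le_pow_right₀ (by norm_num) (Nat.le_succ J))
      rw [if_pos hJ] at ih ⊢
      rw [if_pos hJ', pow_succ, ← div_div]
      linarith
    · have h0 : ∑ j ∈ Finset.range J, (if V ≤ 4 ^ j then V / 4 ^ j else 0) = 0 := by
        refine Finset.sum_eq_zero fun j hj => if_neg fun hj' => hJ (hj'.trans ?_)
        exact pow_le_pow_right₀ (by norm_num) (Finset.mem_range.1 hj).le
      rw [h0, if_neg hJ]
      split_ifs with h
      · have : V / 4 ^ (J + 1) ≤ 1 := (div_le_one (by positivity)).2 h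
        linarith
      · norm_num

lemma measurable_noise_succ {Ω : Type*} {d : ℕ} (M : ℕ → Ω → State d) (x₀ : Ω → State d) (k : ℕ) :
    Measurable[noiseSigma x₀ M (k + 1)] (M (k + 1)) := by
  refine measurable_iff_comap_le.2 (le_sup_of_le_right ?_)
  exact le_iSup₂_of_le (k + 1) (Finset.mem_Icc.2 ⟨by omega, le_rfl⟩) le_rfl

section Probability

variable {Ω : Type*} [mΩ : MeasurableSpace Ω] {d : ℕ} {μ : Measure Ω}
  {x M : ℕ → Ω → State d}

/-- The filtration `σ(x₀, M₁, …, M_n)`. -/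
def noiseFiltration {x₀ : Ω → State d} {M : ℕ → Ω → State d} (hx : Measurable x₀)
    (hM : ∀ n, Measurable (M (n + 1))) : Filtration ℕ mΩ where
  seq n := noiseSigma x₀ M n
  mono' _ _ hij := sup_le_sup_left
    (biSup_mono fun _ hk => Finset.Icc_subset_Icc_right hij hk) _
  le' n := by
    refine sup_le hx.comap_le (iSup₂_le fun k hk => ?_)
    obtain ⟨k, rfl⟩ : ∃ l, k = l + 1 := ⟨k - 1, by have := (Finset.mem_Icc.1 hk).1; omega⟩
    exact (hM k).comap_le

/-- The conditional second moment of the noise. -/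
noncomputable def condVar (μ : Measure Ω) (x M : ℕ → Ω → State d) (k : ℕ) : Ω → ℝ :=
  μ[fun ω => ‖M (k + 1) ω‖ ^ 2 | noiseSigma (x 0) M k]

/-- The weighted noise at scale `2 ^ j`, switched off when its conditional variance is large for
that scale. -/
noncomputable def truncatedNoise (μ : Measure Ω) (a : ℕ → ℝ) (x M : ℕ → Ω → State d)
    (j k : ℕ) : Ω → State d :=
  (a k / 2 ^ j) • {ω | condVar μ x M k ω ≤ 4 ^ j}.indicator (M (k + 1))

lemma measurableSet_condVar_le (k j : ℕ) :
    MeasurableSet[noiseSigma (x 0) M k] {ω | condVar μ x M k ω ≤ 4 ^ j} :=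
  measurableSet_le stronglyMeasurable_condExp.measurable measurable_const

variable [IsProbabilityMeasure μ]

/-- The cut-off depends only on information at time `k`, before `M (k + 1)` is revealed, so it
preserves the zero conditional mean. -/
lemma MartingaleNoise.isL2Difference (A3 : MartingaleNoise μ x M) (a : ℕ → ℝ) (j : ℕ) :
    IsL2Difference (noiseFiltration A3.measurable_init A3.measurable_noise) μ
      (truncatedNoise μ a x M j) where
  meas k := by
    have hs := (noiseFiltration A3.measurable_init A3.measurable_noise).mono (Nat.le_succ k) _
      (measurableSet_condVar_le (μ := μ) (x := x) (M := M) k j)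
    exact (((measurable_noise_succ M (x 0) k).stronglyMeasurable).indicator hs).const_smul _
  memLp k := by
    have hs := (noiseFiltration A3.measurable_init A3.measurable_noise).le k _
      (measurableSet_condVar_le (μ := μ) (x := x) (M := M) k j)
    exact ((A3.sq_integrable k).indicator hs).const_smul _
  condExp_eq_zero k := by
    have h1 := condExp_smul (μ := μ) (a k / 2 ^ j)
      ({ω | condVar μ x M k ω ≤ 4 ^ j}.indicator (M (k + 1))) (noiseSigma (x 0) M k)
    have h2 := condExp_indicator ((A3.sq_integrable k).integrable one_le_two)
      (measurableSet_condVar_le (μ := μ) (x := x) (M := M) k j)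
    filter_upwards [h1, h2, A3.mds k] with ω h1 h2 h3
    refine h1.trans ?_
    rw [Pi.smul_apply, h2, Set.indicator_apply, h3]
    simp

lemma MartingaleNoise.integral_norm_sq_truncatedNoise (A3 : MartingaleNoise μ x M) (a : ℕ → ℝ)
    (j k : ℕ) :
    ∫ ω, ‖truncatedNoise μ a x M j k ω‖ ^ 2 ∂μ = a k ^ 2 *
      ∫ ω, (if condVar μ x M k ω ≤ 4 ^ j then condVar μ x M k ω / 4 ^ j else 0) ∂μ := by
  have hm : noiseSigma (x 0) M k ≤ mΩ :=
    (noiseFiltration A3.measurable_init A3.measurable_noise).le k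
  have hs := measurableSet_condVar_le (μ := μ) (x := x) (M := M) k j
  have hint : Integrable (fun ω => ‖M (k + 1) ω‖ ^ 2) μ :=
    (A3.sq_integrable k).integrable_norm_pow (by norm_num)
  have h4 : (4 : ℝ) ^ j = (2 ^ j) ^ 2 := by rw [← pow_mul, mul_comm, pow_mul]; norm_num
  have h1 : (fun ω => ‖truncatedNoise μ a x M j k ω‖ ^ 2) = fun ω => (a k ^ 2 / 4 ^ j) *
      {ω | condVar μ x M k ω ≤ 4 ^ j}.indicator (fun ω => ‖M (k + 1) ω‖ ^ 2) ω := by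
    funext ω
    simp only [truncatedNoise, Pi.smul_apply, norm_smul, mul_pow, Real.norm_eq_abs, sq_abs,
      div_pow, h4]
    by_cases h : ω ∈ {ω | condVar μ x M k ω ≤ 4 ^ j}
    · rw [h4] at h; simp [Set.indicator_of_mem h]
    · rw [h4] at h; simp [Set.indicator_of_notMem h]
  have h2 : (fun ω => if condVar μ x M k ω ≤ 4 ^ j then condVar μ x M k ω / 4 ^ j else 0)
      = fun ω => (4 ^ j)⁻¹ * {ω | condVar μ x M k ω ≤ 4 ^ j}.indicator (condVar μ x M k) ω := by
    funext ω
    by_cases h : condVar μ x M k ω ≤ 4 ^ j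
    · have : ω ∈ {ω | condVar μ x M k ω ≤ 4 ^ j} := h
      rw [if_pos h, Set.indicator_of_mem this, div_eq_inv_mul]
    · have : ω ∉ {ω | condVar μ x M k ω ≤ 4 ^ j} := h
      rw [if_neg h, Set.indicator_of_notMem this, mul_zero]
  have h3 : ∫ ω in {ω | condVar μ x M k ω ≤ 4 ^ j}, condVar μ x M k ω ∂μ
      = ∫ ω in {ω | condVar μ x M k ω ≤ 4 ^ j}, ‖M (k + 1) ω‖ ^ 2 ∂μ :=
    setIntegral_condExp hm hint hs
  rw [h1, h2, integral_const_mul, integral_const_mul, integral_indicator (hm _ hs),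
    integral_indicator (hm _ hs), h3]
  ring

lemma MartingaleNoise.tsum_integral_le (A3 : MartingaleNoise μ x M) (a : ℕ → ℝ) (k : ℕ) :
    ∑' j, ENNReal.ofReal (∫ ω, ‖truncatedNoise μ a x M j k ω‖ ^ 2 ∂μ)
      ≤ ENNReal.ofReal (2 * a k ^ 2) := by
  have hm : noiseSigma (x 0) M k ≤ mΩ :=
    (noiseFiltration A3.measurable_init A3.measurable_noise).le k
  have hV : 0 ≤ᵐ[μ] condVar μ x M k := condExp_nonneg (ae_of_all _ fun ω => by positivity)
  refine ENNReal.tsum_le_of_sum_range_le fun J => ?_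
  rw [← ENNReal.ofReal_sum_of_nonneg fun j _ => integral_nonneg fun ω => by positivity]
  refine ENNReal.ofReal_le_ofReal ?_
  simp_rw [A3.integral_norm_sq_truncatedNoise a]
  rw [← Finset.mul_sum, mul_comm (2 : ℝ)]
  refine mul_le_mul_of_nonneg_left ?_ (sq_nonneg _)
  have hint : ∀ j ∈ Finset.range J, Integrable (fun ω =>
      if condVar μ x M k ω ≤ 4 ^ j then condVar μ x M k ω / 4 ^ j else 0) μ := by
    intro j _
    have : Integrable ({ω | condVar μ x M k ω ≤ 4 ^ j}.indicator
        fun ω => condVar μ x M k ω / 4 ^ j) μ :=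
      (integrable_condExp.div_const _).indicator (hm _ (measurableSet_condVar_le k j))
    refine this.congr (ae_of_all _ fun ω => ?_)
    simp [Set.indicator_apply]
  rw [← integral_finsetSum _ hint]
  calc _ ≤ ∫ _ : Ω, (2 : ℝ) ∂μ := by
        refine integral_mono_ae (integrable_finsetSum _ hint) (integrable_const _) ?_
        filter_upwards [hV] with ω hω
        exact sum_truncated_le hω J
    _ = 2 := by simp

/-- Almost surely the weighted noise is negligible at every scale. -/
theorem MartingaleNoise.ae_noiseNegligible (A3 : MartingaleNoise μ x M) {a : ℕ → ℝ}
    (ha : Summable fun n => a n ^ 2) :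
    ∀ᵐ ω ∂μ, NoiseNegligible a (fun n => x n ω) (fun n => M n ω) := by
  obtain ⟨K, hK, hKn⟩ := A3.cond_sq_le
  have hcauchy := ae_uniform_cauchy (fun j => A3.isL2Difference a j) (ha.mul_left 2)
    (A3.tsum_integral_le a)
  filter_upwards [hcauchy, ae_all_iff.2 hKn] with ω hω hV ε hε
  -- In the ball of radius `R` the conditional variance is at most `K * (1 + R ^ 2) ≤ b * R ^ 2 ≤ (b
  -- * R) ^ 2`.
  set b : ℝ := max 1 (2 * K) with hb
  have hb1 : 1 ≤ b := le_max_left _ _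
  have hbK : 2 * K ≤ b := le_max_right _ _
  obtain ⟨N, hN⟩ := hω (ε / (2 * b)) (by positivity)
  refine ⟨N, fun n hn n' hn' R hR hx => ?_⟩
  -- Since `2 ^ j ≤ b * R < 2 ^ (j + 1)`, the cut-off at scale `j + 1` is inactive, while undoing
  -- the scaling costs at most the factor `2 * b * R` allowed for in `ε / (2 * b)`.
  obtain ⟨j, hj1, hj2⟩ := exists_nat_pow_near (show 1 ≤ b * R by nlinarith) (one_lt_two (α := ℝ))
  have hle : ∀ k ∈ Finset.Ico n n', truncatedNoise μ a x M (j + 1) k ω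
      = (2 ^ (j + 1) : ℝ)⁻¹ • (a k • M (k + 1) ω) := by
    intro k hk
    rw [Finset.mem_Ico] at hk
    have hmem : ω ∈ {ω | condVar μ x M k ω ≤ 4 ^ (j + 1)} := by
      have h4 : (4 : ℝ) ^ (j + 1) = (2 ^ (j + 1)) ^ 2 := by
        rw [← pow_mul, mul_comm, pow_mul]; norm_num
      have hxk := hx k hk.1 hk.2
      have hx2 : ‖x k ω‖ ^ 2 ≤ R ^ 2 := pow_le_pow_left₀ (norm_nonneg _) hxk 2
      have hbR : (b * R) ^ 2 ≤ (2 ^ (j + 1)) ^ 2 := pow_le_pow_left₀ (by positivity) hj2.le 2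
      have hR2 : 1 ≤ R ^ 2 := one_le_pow₀ hR
      calc condVar μ x M k ω ≤ K * (1 + ‖x k ω‖ ^ 2) := hV k
        _ ≤ K * (2 * R ^ 2) := by gcongr; linarith
        _ ≤ b * R ^ 2 := by nlinarith
        _ ≤ (b * R) ^ 2 := by
            rw [mul_pow]
            exact mul_le_mul_of_nonneg_right (by nlinarith) (by positivity)
        _ ≤ 4 ^ (j + 1) := by rw [h4]; exact hbR
    rw [truncatedNoise, Pi.smul_apply, Set.indicator_of_mem hmem, smul_smul, div_eq_inv_mul]
  have hmain := hN n hn n' hn' (j + 1)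
  rw [Finset.sum_congr rfl hle, ← Finset.smul_sum, norm_smul, Real.norm_of_nonneg (by positivity),
    inv_mul_le_iff₀ (by positivity)] at hmain
  refine hmain.trans ?_
  calc (2 : ℝ) ^ (j + 1) * (ε / (2 * b)) ≤ 2 * (b * R) * (ε / (2 * b)) := by
        rw [pow_succ']; gcongr
    _ = ε * R := by field_simp

end Probability

/-! ### The clock of the iteration -/

/-- The time `a 0 + ⋯ + a (n - 1)` at which the `n`-th iterate is reached. -/
noncomputable def clock (a : ℕ → ℝ) (n : ℕ) : ℝ := ∑ i ∈ Finset.range n, a i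

/-- The first iterate reached at time `s` or later. -/
noncomputable def clockIndex (a : ℕ → ℝ) (s : ℝ) : ℕ := sInf {k | s ≤ clock a k}

lemma clock_succ (a : ℕ → ℝ) (n : ℕ) : clock a (n + 1) = clock a n + a n :=
  Finset.sum_range_succ _ _

lemma sum_Ico_eq_clock_sub (a : ℕ → ℝ) {k l : ℕ} (h : k ≤ l) :
    ∑ j ∈ Finset.Ico k l, a j = clock a l - clock a k :=
  Finset.sum_Ico_eq_sub _ h

lemma clock_lt_of_lt_clockIndex {a : ℕ → ℝ} {s : ℝ} {k : ℕ} (h : k < clockIndex a s) : clock a k < s :=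
  not_le.1 fun hk => (Nat.sInf_le (s := {k | s ≤ clock a k}) hk).not_gt h

lemma clockIndex_le {a : ℕ → ℝ} {s : ℝ} {k : ℕ} (h : s ≤ clock a k) : clockIndex a s ≤ k :=
  Nat.sInf_le (s := {k | s ≤ clock a k}) h

namespace StepSizes

variable {a : ℕ → ℝ}

lemma clock_strictMono (A2 : StepSizes a) : StrictMono (clock a) :=
  strictMono_nat_of_lt_succ fun n => by rw [clock_succ]; linarith [A2.pos n]

lemma tendsto_zero (A2 : StepSizes a) : Tendsto a atTop (𝓝 0) := by
  have h := A2.sq_summable.tendsto_atTop_zero.sqrt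
  simpa [Real.sqrt_sq (A2.pos _).le] using h

lemma exists_le_clock (A2 : StepSizes a) (s : ℝ) : {k | s ≤ clock a k}.Nonempty :=
  (A2.sum_diverges.eventually_ge_atTop s).exists

lemma le_clock_clockIndex (A2 : StepSizes a) (s : ℝ) : s ≤ clock a (clockIndex a s) :=
  Nat.sInf_mem (A2.exists_le_clock s)

lemma clockIndex_clock (A2 : StepSizes a) (n : ℕ) : clockIndex a (clock a n) = n :=
  le_antisymm (clockIndex_le le_rfl)
    (A2.clock_strictMono.le_iff_le.1 (A2.le_clock_clockIndex _))

lemma clockIndex_mono (A2 : StepSizes a) : Monotone (clockIndex a) := fun _ _ h =>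
  clockIndex_le (h.trans (A2.le_clock_clockIndex _))

lemma le_clockIndex_add (A2 : StepSizes a) (n : ℕ) {s : ℝ} (hs : 0 ≤ s) : n ≤ clockIndex a (clock a n + s) := by
  conv_lhs => rw [← A2.clockIndex_clock n]
  exact A2.clockIndex_mono (by linarith)

/-- The overshoot is less than one step, and all steps after a late iterate are small; hence the
uniformity in `s`. -/
lemma eventually_clock_clockIndex_lt (A2 : StepSizes a) {η : ℝ} (hη : 0 < η) :
    ∀ᶠ n in atTop, ∀ s, 0 ≤ s →
      clock a (clockIndex a (clock a n + s)) < clock a n + s + η := by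
  obtain ⟨N, hN⟩ := eventually_atTop.1 (A2.tendsto_zero.eventually_lt_const hη)
  filter_upwards [eventually_ge_atTop N] with n hn s hs
  rcases (A2.le_clockIndex_add n hs).eq_or_lt with h | h
  · rw [← h]; linarith
  · obtain ⟨k, hk⟩ : ∃ k, clockIndex a (clock a n + s) = k + 1 :=
      Nat.exists_eq_add_one.2 (by omega)
    have h1 := clock_lt_of_lt_clockIndex (a := a) (s := clock a n + s) (k := k) (by omega)
    rw [hk, clock_succ]
    linarith [hN k (by omega)]

end StepSizes

/-! ### Noisy paths and their growth -/

/-- A sample path of the recursive inclusion whose noise is negligible. -/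
structure IsNoisyPath {d : ℕ} (h : State d → Set (State d)) (a : ℕ → ℝ) (x y m : ℕ → State d) :
    Prop where
  step : ∀ n, x (n + 1) = x n + a n • (y n + m (n + 1))
  mem : ∀ n, y n ∈ h (x n)
  noise : NoiseNegligible a x m

namespace IsNoisyPath

variable {d : ℕ} {h : State d → Set (State d)} {a : ℕ → ℝ} {x y m : ℕ → State d}

lemma sub_eq (hp : IsNoisyPath h a x y m) {k l : ℕ} (hkl : k ≤ l) :
    x l - x k = ∑ j ∈ Finset.Ico k l, a j • y j + ∑ j ∈ Finset.Ico k l, a j • m (j + 1) := by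
  rw [← Finset.sum_add_distrib, ← Finset.sum_Ico_sub x hkl]
  refine Finset.sum_congr rfl fun j _ => ?_
  rw [hp.step, smul_add]; abel

/-- On windows of bounded length the path grows at most by a constant factor. -/
theorem eventually_norm_le (hp : IsNoisyPath h a x y m) (A2 : StepSizes a) {K : ℝ} (hK : 0 < K)
    (hg : ∀ x, ∀ w ∈ h x, ‖w‖ < K * (1 + ‖x‖)) (T : ℝ) :
    ∃ C : ℝ, 1 ≤ C ∧ ∀ᶠ n in atTop, ∀ k, n ≤ k → clock a k ≤ clock a n + T →
      ‖x k‖ ≤ C * max 1 ‖x n‖ := by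
  rcases lt_or_ge T 0 with hT | hT
  · refine ⟨1, le_rfl, Eventually.of_forall fun n k hk hkT => ?_⟩
    linarith [A2.clock_strictMono.monotone hk]
  set C : ℝ := Real.exp (K * T) * 3 with hC
  have hC1 : 1 ≤ C := by
    have : 1 ≤ Real.exp (K * T) := Real.one_le_exp (by positivity)
    linarith
  obtain ⟨N, hN⟩ := hp.noise C⁻¹ (by positivity)
  refine ⟨C, hC1, eventually_atTop.2 ⟨N, fun n hn k hk => ?_⟩⟩
  set r := max 1 ‖x n‖ with hr
  have hr1 : 1 ≤ r := le_max_left _ _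
  have hxr : ‖x n‖ ≤ r := le_max_right _ _
  -- A bootstrap: noise up to `k` only needs the bound `C * r` at earlier iterates, and the
  -- tolerance `C⁻¹` then makes it at most `r`.
  induction k using Nat.strong_induction_on with
  | _ k ih =>
    intro hkT
    have hmono := A2.clock_strictMono.monotone
    have hnoise : ∀ l, n ≤ l → l ≤ k → ‖∑ j ∈ Finset.Ico n l, a j • m (j + 1)‖ ≤ r := by
      intro l hnl hlk
      have := hN n hn l hnl (C * r) (by nlinarith) fun j hj hjl =>
        ih j (by omega) hj ((hmono (by omega : j ≤ k)).trans hkT)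
      rwa [inv_mul_cancel_left₀ (by positivity)] at this
    -- Discrete Gronwall for the path with its noise subtracted. The initial value is at most `3 *
    -- r`, and the summand `r` kept on the left pays for restoring the noise at the end.
    have hu : ∀ l, n ≤ l → l ≤ k → 1 + r + ‖x l - ∑ j ∈ Finset.Ico n l, a j • m (j + 1)‖
        ≤ Real.exp (K * (clock a l - clock a n)) * (3 * r) := by
      intro l hnl
      induction l, hnl using Nat.le_induction with
      | base => intro _; simp; linarith
      | succ l hnl ihl =>
        intro hlk
        have ihl := ihl (by omega)
        set Z := ∑ j ∈ Finset.Ico n l, a j • m (j + 1) with hZ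
        have hZr : ‖Z‖ ≤ r := hnoise l hnl (by omega)
        have hxl : ‖x l‖ ≤ ‖x l - Z‖ + r := by
          have := norm_add_le (x l - Z) Z
          rw [sub_add_cancel] at this
          linarith
        have hstep : x (l + 1) - ∑ j ∈ Finset.Ico n (l + 1), a j • m (j + 1)
            = (x l - Z) + a l • y l := by
          rw [Finset.sum_Ico_succ_top hnl, hp.step, smul_add, ← hZ]; abel
        have hy := (hg _ _ (hp.mem l)).le
        have ha := A2.pos l
        have h1 : ‖x (l + 1) - ∑ j ∈ Finset.Ico n (l + 1), a j • m (j + 1)‖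
            ≤ ‖x l - Z‖ + a l * (K * (1 + r + ‖x l - Z‖)) := by
          rw [hstep]
          refine (norm_add_le _ _).trans ?_
          rw [norm_smul, Real.norm_of_nonneg ha.le]
          gcongr
          exact hy.trans (mul_le_mul_of_nonneg_left (by linarith) hK.le)
        calc 1 + r + ‖x (l + 1) - ∑ j ∈ Finset.Ico n (l + 1), a j • m (j + 1)‖
            ≤ (K * a l + 1) * (1 + r + ‖x l - Z‖) := by linarith
          _ ≤ Real.exp (K * a l) * (Real.exp (K * (clock a l - clock a n)) * (3 * r)) := by
              gcongr
              exact Real.add_one_le_exp _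
          _ = Real.exp (K * (clock a (l + 1) - clock a n)) * (3 * r) := by
              rw [← mul_assoc, ← Real.exp_add, clock_succ]; ring_nf
    have h1 := hu k hk le_rfl
    have h2 := hnoise k hk le_rfl
    have h3 := norm_add_le (x k - ∑ j ∈ Finset.Ico n k, a j • m (j + 1))
      (∑ j ∈ Finset.Ico n k, a j • m (j + 1))
    rw [sub_add_cancel] at h3
    have h4 : Real.exp (K * (clock a k - clock a n)) * (3 * r) ≤ Real.exp (K * T) * (3 * r) := by
      gcongr; linarith
    rw [hC, mul_assoc]
    linarith

end IsNoisyPath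

/-! ### Limits of rescaled paths -/

/-- A locally Lipschitz curve whose right difference quotients at `t` are eventually within `ε` of
`H (φ t)`, for every `ε > 0`, is a solution of `ẋ ∈ H(x)`. -/
theorem isSolution_of_right_quotients {d : ℕ} {H : State d → Set (State d)} {φ : ℝ → State d}
    (hclosed : ∀ z, IsClosed (H z))
    (hlip : ∀ T : ℝ, ∃ L : NNReal, LipschitzOnWith L φ (Set.Icc 0 T))
    (hquot : ∀ t, 0 < t → ∀ ε : ℝ, 0 < ε →
      ∀ᶠ s in 𝓝[>] t, (s - t)⁻¹ • (φ s - φ t) ∈ Metric.cthickening ε (H (φ t))) :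
    IsSolution H φ where
  absCont T hT := by
    obtain ⟨L, hL⟩ := hlip T
    exact LipschitzOnWith.absolutelyContinuousOnInterval (by rwa [Set.uIcc_of_le hT])
  inclusion := by
    -- Rademacher's theorem on each `[0, N]`.
    have hdiff : ∀ᵐ t : ℝ, ∀ N : ℕ, t ∈ Set.Icc (0 : ℝ) N →
        DifferentiableWithinAt ℝ φ (Set.Icc 0 (N : ℝ)) t := ae_all_iff.2 fun N => by
      obtain ⟨L, hL⟩ := hlip N
      exact hL.ae_differentiableWithinAt_of_mem_real
    filter_upwards [ae_restrict_of_ae hdiff, ae_restrict_mem measurableSet_Ioi] with t ht ht0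
    rw [Set.mem_Ioi] at ht0
    obtain ⟨N, hN⟩ := exists_nat_gt t
    have hd : DifferentiableAt ℝ φ t :=
      (ht N ⟨ht0.le, hN.le⟩).differentiableAt (Icc_mem_nhds ht0 hN)
    refine ⟨deriv φ t, ?_, hd.hasDerivAt⟩
    have hslope : Tendsto (slope φ t) (𝓝[>] t) (𝓝 (deriv φ t)) :=
      (hasDerivAt_iff_tendsto_slope.1 hd.hasDerivAt).mono_left
        (nhdsWithin_mono _ fun s hs => ne_of_gt hs)
    rw [← (hclosed (φ t)).closure_eq, Metric.closure_eq_iInter_cthickening]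
    refine Set.mem_iInter₂.2 fun ε hε => ?_
    refine Metric.isClosed_cthickening.mem_of_tendsto hslope ?_
    filter_upwards [hquot t ht0 ε hε] with s hs
    rwa [slope_def_module]

/-- The path started at the `n`-th iterate, in continuous time and scaled by `c⁻¹`. -/
noncomputable def shifted {d : ℕ} (a : ℕ → ℝ) (x : ℕ → State d) (n : ℕ) (c s : ℝ) : State d :=
  c⁻¹ • x (clockIndex a (clock a n + s))

section Limit

variable {d : ℕ} {h : State d → Set (State d)} {a : ℕ → ℝ} {x y m : ℕ → State d}
  {ι : Type*} {l : Filter ι} {n : ι → ℕ} {c : ι → ℝ}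

/-- On windows of bounded length after the iterates `n i` the path is of order `c i`. -/
def BoundedWindows (a : ℕ → ℝ) (x : ℕ → State d) (l : Filter ι) (n : ι → ℕ) (c : ι → ℝ) : Prop :=
  ∀ T : ℝ, ∃ C : ℝ, 1 ≤ C ∧ ∀ᶠ i in l, ∀ k, n i ≤ k → clock a k ≤ clock a (n i) + T →
    ‖x k‖ ≤ C * c i

namespace IsNoisyPath

lemma eventually_window (A2 : StepSizes a) (hn : Tendsto n l atTop) {η : ℝ} (hη : 0 < η) :
    ∀ᶠ i in l, ∀ s, 0 ≤ s →
      clock a (clockIndex a (clock a (n i) + s)) < clock a (n i) + s + η :=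
  hn.eventually (A2.eventually_clock_clockIndex_lt hη)

lemma eventually_norm_shifted_le (A2 : StepSizes a) (hn : Tendsto n l atTop)
    (hc : ∀ i, 1 ≤ c i) (hbd : BoundedWindows a x l n c) (T : ℝ) :
    ∃ C : ℝ, ∀ᶠ i in l, ∀ s ∈ Set.Icc 0 T, ‖shifted a x (n i) (c i) s‖ ≤ C := by
  obtain ⟨C, -, hC⟩ := hbd (T + 1)
  refine ⟨C, ?_⟩
  filter_upwards [hC, eventually_window A2 hn one_pos] with i hi hw s hs
  have hci : 0 < c i := one_pos.trans_le (hc i)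
  rw [shifted, norm_smul, norm_inv, Real.norm_of_nonneg hci.le, inv_mul_le_iff₀ hci, mul_comm]
  exact hi _ (A2.le_clockIndex_add _ hs.1) (by linarith [hw s hs.1, hs.2])

lemma eventually_noise_le (hp : IsNoisyPath h a x y m) (A2 : StepSizes a)
    (hn : Tendsto n l atTop) (hc : ∀ i, 1 ≤ c i) (hbd : BoundedWindows a x l n c) (T : ℝ)
    {ε : ℝ} (hε : 0 < ε) :
    ∀ᶠ i in l, ∀ k k', n i ≤ k → k ≤ k' → clock a k' ≤ clock a (n i) + T →
      ‖∑ j ∈ Finset.Ico k k', a j • m (j + 1)‖ ≤ ε * c i := by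
  obtain ⟨C, hC1, hC⟩ := hbd T
  obtain ⟨N, hN⟩ := hp.noise (ε / C) (by positivity)
  filter_upwards [hC, hn.eventually_ge_atTop N] with i hi hni k k' hk hkk' hT
  have h1 : 1 ≤ C * c i := by nlinarith [hc i]
  have := hN k (hni.trans hk) k' hkk' (C * c i) h1 fun j hj hjk' =>
    hi j (hk.trans hj) ((A2.clock_strictMono.monotone hjk'.le).trans hT)
  rwa [← mul_assoc, div_mul_cancel₀ _ (by positivity)] at this

lemma shifted_sub (hp : IsNoisyPath h a x y m) (A2 : StepSizes a) (n : ℕ) (c : ℝ) {s s' : ℝ}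
    (hs : s ≤ s') :
    shifted a x n c s' - shifted a x n c s =
      ∑ j ∈ Finset.Ico (clockIndex a (clock a n + s)) (clockIndex a (clock a n + s')),
        a j • (c⁻¹ • y j) +
      c⁻¹ • ∑ j ∈ Finset.Ico (clockIndex a (clock a n + s)) (clockIndex a (clock a n + s')),
        a j • m (j + 1) := by
  rw [shifted, shifted, ← smul_sub, hp.sub_eq (A2.clockIndex_mono (by linarith)), smul_add,
    Finset.smul_sum]
  congr 1
  exact Finset.sum_congr rfl fun j _ => smul_comm _ _ _

/-- The shifted paths are step functions, so only a Lipschitz bound with a vanishing error is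
possible. Linear growth and `1 ≤ c i` bound the rescaled drift by `K * (1 + C)`; noise and clock
overshoot go into `ε`. -/
lemma eventually_dist_shifted_le (hp : IsNoisyPath h a x y m) (A2 : StepSizes a)
    (hn : Tendsto n l atTop) (hc : ∀ i, 1 ≤ c i) (hbd : BoundedWindows a x l n c)
    (hg : ∃ K : ℝ, 0 < K ∧ ∀ x, ∀ w ∈ h x, ‖w‖ < K * (1 + ‖x‖)) (T : ℝ) :
    ∃ L : NNReal, ∀ ε : ℝ, 0 < ε → ∀ᶠ i in l, ∀ s ∈ Set.Icc 0 T, ∀ s' ∈ Set.Icc 0 T,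
      dist (shifted a x (n i) (c i) s) (shifted a x (n i) (c i) s') ≤ L * dist s s' + ε := by
  obtain ⟨K, hK, hKh⟩ := hg
  obtain ⟨C, hC1, hC⟩ := hbd (T + 1)
  set L : NNReal := ⟨K * (1 + C), by positivity⟩ with hL
  have hL' : (L : ℝ) = K * (1 + C) := rfl
  have hL0 : 0 < (L : ℝ) := by rw [hL']; positivity
  refine ⟨L, fun ε hε => ?_⟩
  set η : ℝ := min 1 (ε / (2 * L)) with hη
  have hη0 : 0 < η := by positivity
  have hηL : L * η ≤ ε / 2 := by
    have := min_le_right 1 (ε / (2 * (L : ℝ)))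
    calc (L : ℝ) * η ≤ L * (ε / (2 * L)) := by gcongr
      _ = ε / 2 := by field_simp
  filter_upwards [hC, eventually_window A2 hn hη0,
    hp.eventually_noise_le A2 hn hc hbd (T + 1) (half_pos hε)] with i hi hw hnoise
  have hci : 0 < c i := one_pos.trans_le (hc i)
  have main : ∀ s s', 0 ≤ s → s ≤ s' → s' ≤ T →
      dist (shifted a x (n i) (c i) s') (shifted a x (n i) (c i) s) ≤ L * (s' - s) + ε := by
    intro s s' hs hss' hs'
    set k := clockIndex a (clock a (n i) + s) with hk
    set k' := clockIndex a (clock a (n i) + s') with hk'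
    have hkk' : k ≤ k' := A2.clockIndex_mono (by linarith)
    have hnk : n i ≤ k := A2.le_clockIndex_add _ hs
    have hwk' : clock a k' ≤ clock a (n i) + s' + η := (hw s' (hs.trans hss')).le
    have hk'T : clock a k' ≤ clock a (n i) + (T + 1) := by
      linarith [min_le_left 1 (ε / (2 * (L : ℝ)))]
    have hkk : clock a (n i) + s ≤ clock a k := A2.le_clock_clockIndex _
    rw [dist_eq_norm, hp.shifted_sub A2 _ _ hss']
    have h1 : ‖∑ j ∈ Finset.Ico k k', a j • ((c i)⁻¹ • y j)‖ ≤ L * (s' - s + η) := by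
      calc ‖∑ j ∈ Finset.Ico k k', a j • ((c i)⁻¹ • y j)‖
          ≤ ∑ j ∈ Finset.Ico k k', a j * L := by
            refine norm_sum_le_of_le _ fun j hj => ?_
            rw [Finset.mem_Ico] at hj
            rw [norm_smul, Real.norm_of_nonneg (A2.pos j).le]
            refine mul_le_mul_of_nonneg_left ?_ (A2.pos j).le
            rw [norm_smul, norm_inv, Real.norm_of_nonneg hci.le, inv_mul_le_iff₀ hci, hL']
            have hxj := hi j (hnk.trans hj.1)
              ((A2.clock_strictMono.monotone hj.2.le).trans hk'T)
            have hyj := (hKh _ _ (hp.mem j)).le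
            have : K * (1 + ‖x j‖) ≤ K * (c i + C * c i) := by gcongr; exact hc i
            linarith
        _ = L * (clock a k' - clock a k) := by
            rw [← Finset.sum_mul, sum_Ico_eq_clock_sub a hkk', mul_comm]
        _ ≤ L * (s' - s + η) := mul_le_mul_of_nonneg_left (by linarith) hL0.le
    have h2 : ‖(c i)⁻¹ • ∑ j ∈ Finset.Ico k k', a j • m (j + 1)‖ ≤ ε / 2 := by
      rw [norm_smul, norm_inv, Real.norm_of_nonneg hci.le, inv_mul_le_iff₀ hci, mul_comm]
      exact hnoise k k' hnk hkk' hk'T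
    refine (norm_add_le _ _).trans ?_
    linarith
  intro s hs s' hs'
  rcases le_total s s' with h' | h'
  · rw [dist_comm (shifted _ _ _ _ _), dist_comm s, Real.dist_eq, abs_of_nonneg (by linarith)]
    exact main s s' hs.1 h' hs'.2
  · rw [Real.dist_eq, abs_of_nonneg (by linarith)]
    exact main s' s hs'.1 h' hs.2

/-- If the rescaled fields near the starting point take values in a closed convex set, so do the
difference quotients of the limit. -/
lemma quotient_mem_of_tendsto (hp : IsNoisyPath h a x y m) (A2 : StepSizes a) [l.NeBot]
    (hn : Tendsto n l atTop) (hc : ∀ i, 1 ≤ c i) (hbd : BoundedWindows a x l n c)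
    {Q : Set (State d)} (hQ : IsClosed Q) (hQc : Convex ℝ Q) {s s' : ℝ} (hs : 0 ≤ s)
    (hss' : s < s') {p p' : State d}
    (hsp : Tendsto (fun i => shifted a x (n i) (c i) s) l (𝓝 p))
    (hsp' : Tendsto (fun i => shifted a x (n i) (c i) s') l (𝓝 p'))
    (hmem : ∀ᶠ i in l, ∀ r ∈ Set.Icc s s', rescale h (c i) (shifted a x (n i) (c i) r) ⊆ Q) :
    (s' - s)⁻¹ • (p' - p) ∈ Q := by
  set k : ι → ℕ := fun i => clockIndex a (clock a (n i) + s) with hk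
  set k' : ι → ℕ := fun i => clockIndex a (clock a (n i) + s') with hk'
  have hs' : 0 ≤ s' := hs.trans hss'.le
  have hkk' : ∀ i, k i ≤ k' i := fun i => A2.clockIndex_mono (by linarith)
  have hτ : Tendsto (fun i => clock a (k' i) - clock a (k i)) l (𝓝 (s' - s)) := by
    rw [Metric.tendsto_nhds]
    intro η hη
    filter_upwards [eventually_window A2 hn hη] with i hw
    have h1 := hw s hs
    have h2 := hw s' hs'
    have h3 := A2.le_clock_clockIndex (clock a (n i) + s)
    have h4 := A2.le_clock_clockIndex (clock a (n i) + s')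
    rw [Real.dist_eq, abs_lt]
    constructor <;> linarith
  have hnoise : Tendsto (fun i => (c i)⁻¹ • ∑ j ∈ Finset.Ico (k i) (k' i), a j • m (j + 1))
      l (𝓝 0) := by
    rw [Metric.tendsto_nhds]
    intro η hη
    filter_upwards [hp.eventually_noise_le A2 hn hc hbd (s' + 1) (half_pos hη),
      eventually_window A2 hn one_pos] with i hi hw
    have hci : 0 < c i := one_pos.trans_le (hc i)
    rw [dist_zero_right, norm_smul, norm_inv, Real.norm_of_nonneg hci.le, inv_mul_lt_iff₀ hci,
      mul_comm]
    refine (hi (k i) (k' i) (A2.le_clockIndex_add _ hs) (hkk' i)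
      (by linarith [hw s' hs'])).trans_lt ?_
    exact mul_lt_mul_of_pos_right (by linarith) hci
  -- Dividing by the elapsed clock time instead of `s' - s` makes the weights of the drift sum to
  -- exactly one, so each approximant is a genuine convex combination.
  have hlim := (hτ.inv₀ (sub_pos.2 hss').ne').smul ((hsp'.sub hsp).sub hnoise)
  rw [sub_zero] at hlim
  refine hQ.mem_of_tendsto hlim ?_
  filter_upwards [hmem, hτ.eventually_const_lt (sub_pos.2 hss')] with i hi hpos
  have hci : 0 < c i := one_pos.trans_le (hc i)
  rw [hp.shifted_sub A2 _ _ hss'.le, add_sub_cancel_right, Finset.smul_sum]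
  simp_rw [smul_smul (clock a (k' i) - clock a (k i))⁻¹]
  refine hQc.sum_mem (fun j _ => ?_) ?_ fun j hj => ?_
  · exact mul_nonneg (inv_nonneg.2 hpos.le) (A2.pos j).le
  · rw [← Finset.mul_sum, sum_Ico_eq_clock_sub a (hkk' i), inv_mul_cancel₀ hpos.ne']
  · rw [Finset.mem_Ico] at hj
    have h1 : clock a (n i) + s ≤ clock a j :=
      (A2.le_clock_clockIndex _).trans (A2.clock_strictMono.monotone hj.1)
    have h2 : clock a j < clock a (n i) + s' := clock_lt_of_lt_clockIndex hj.2
    -- Iterate `j` is the value of the shifted path at this time, which lies in `[s, s')`.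
    refine hi (clock a j - clock a (n i)) ⟨by linarith, by linarith⟩ ?_
    rw [shifted, add_sub_cancel, A2.clockIndex_clock, rescale, Set.mem_ofPred_eq,
      smul_inv_smul₀ hci.ne', smul_inv_smul₀ hci.ne']
    exact hp.mem j

/-- Along an ultrafilter the rescaled shifts of a path converge, uniformly on bounded intervals, to
a solution of the limiting inclusion. -/
theorem exists_limit_solution (hp : IsNoisyPath h a x y m) (A2 : StepSizes a)
    {U : Ultrafilter ι} (hn : Tendsto n U atTop) (hc : ∀ i, 1 ≤ c i)
    (hbd : BoundedWindows a x U n c)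
    (hg : ∃ K : ℝ, 0 < K ∧ ∀ x, ∀ w ∈ h x, ‖w‖ < K * (1 + ‖x‖))
    {H : State d → Set (State d)} (hclosed : ∀ z, IsClosed (H z)) (hconv : ∀ z, Convex ℝ (H z))
    (husc : ∀ z, ∀ ε : ℝ, 0 < ε → ∃ δ : ℝ, 0 < δ ∧ ∀ᶠ i in U, ∀ u ∈ Metric.ball z δ,
      rescale h (c i) u ⊆ Metric.cthickening ε (H z)) :
    ∃ φ : ℝ → State d, IsSolution H φ ∧
      (∀ s, 0 ≤ s → Tendsto (fun i => shifted a x (n i) (c i) s) U (𝓝 (φ s))) ∧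
      ∀ T ε : ℝ, 0 < ε → ∀ᶠ i in (U : Filter ι), ∀ s ∈ Set.Icc 0 T,
        dist (shifted a x (n i) (c i) s) (φ s) < ε := by
  have hex : ∀ s : ℝ, ∃ p, 0 ≤ s → Tendsto (fun i => shifted a x (n i) (c i) s) U (𝓝 p) := by
    intro s
    rcases lt_or_ge s 0 with hs | hs
    · exact ⟨0, fun h => absurd h hs.not_ge⟩
    obtain ⟨C, hC⟩ := eventually_norm_shifted_le A2 hn hc hbd s
    -- The ultrafilter yields limits at all times at once, with no diagonal extraction.
    obtain ⟨p, -, hp⟩ := (isCompact_closedBall (0 : State d) C).ultrafilter_le_nhds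
      (U.map fun i => shifted a x (n i) (c i) s) (by
        rw [le_principal_iff, Ultrafilter.coe_map, mem_map]
        filter_upwards [hC] with i hi
        exact mem_closedBall_zero_iff.2 (hi s ⟨hs, le_rfl⟩))
    exact ⟨p, fun _ => hp⟩
  choose φ hφ using hex
  have hequi := hp.eventually_dist_shifted_le A2 hn hc hbd hg
  have hlip : ∀ T : ℝ, ∃ L : NNReal, LipschitzOnWith L φ (Set.Icc 0 T) ∧
      ∀ ε : ℝ, 0 < ε → ∀ᶠ i in (U : Filter ι), ∀ s ∈ Set.Icc 0 T, ∀ s' ∈ Set.Icc 0 T,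
      dist (shifted a x (n i) (c i) s) (shifted a x (n i) (c i) s') ≤ L * dist s s' + ε := by
    intro T
    obtain ⟨L, hL⟩ := hequi T
    refine ⟨L, LipschitzOnWith.of_dist_le_mul fun s hs s' hs' => ?_, hL⟩
    refine le_of_forall_pos_le_add fun ε hε => ?_
    refine le_of_tendsto ((hφ s hs.1).dist (hφ s' hs'.1)) ?_
    filter_upwards [hL ε hε] with i hi using hi s hs s' hs'
  refine ⟨φ, isSolution_of_right_quotients hclosed
    (fun T => (hlip T).imp fun _ h => h.1) ?_, hφ, ?_⟩
  · intro t ht ε hε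
    obtain ⟨δ, hδ, hδU⟩ := husc (φ t) ε hε
    obtain ⟨L, -, hL⟩ := hlip (t + 1)
    -- Three errors of at most `δ / 4` arise below: the Lipschitz term, its additive error, and
    -- convergence at `t`. Using `L + 1` avoids dividing by zero.
    have hδ' : 0 < min 1 (δ / (4 * (L + 1))) := by positivity
    filter_upwards [Ioo_mem_nhdsGT (lt_add_of_pos_right t hδ')] with s hs
    have hs1 : s ≤ t + 1 := by linarith [hs.2, min_le_left 1 (δ / (4 * ((L : ℝ) + 1)))]
    have hLs : L * (s - t) ≤ δ / 4 := by
      have h1 : s - t ≤ δ / (4 * (L + 1)) := by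
        linarith [hs.2, min_le_right 1 (δ / (4 * ((L : ℝ) + 1)))]
      calc (L : ℝ) * (s - t) ≤ (L + 1) * (δ / (4 * (L + 1))) := by
            gcongr
            · linarith [hs.1]
            · linarith
        _ = δ / 4 := by field_simp
    refine hp.quotient_mem_of_tendsto A2 hn hc hbd Metric.isClosed_cthickening
      ((hconv _).cthickening ε) ht.le hs.1 (hφ t ht.le) (hφ s (ht.trans hs.1).le) ?_
    filter_upwards [hδU, hL (δ / 4) (by positivity),
      Metric.tendsto_nhds.1 (hφ t ht.le) (δ / 4) (by positivity)] with i hi hiL hit r hr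
    refine hi _ ?_
    rw [Metric.mem_ball]
    have h1 := hiL r ⟨ht.le.trans hr.1, hr.2.trans hs1⟩ t ⟨ht.le, by linarith⟩
    have h2 : L * dist r t ≤ L * (s - t) := by
      rw [Real.dist_eq, abs_of_nonneg (by linarith [hr.1])]
      gcongr
      exact hr.2
    have h3 := dist_triangle (shifted a x (n i) (c i) r) (shifted a x (n i) (c i) t) (φ t)
    linarith
  · intro T ε hε
    by_contra hcon
    rw [← Ultrafilter.eventually_not] at hcon
    push Not at hcon
    obtain ⟨L, hLφ, hL⟩ := hlip T
    -- Bad times are selected, with default `0` where there are none. They converge along the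
    -- ultrafilter, and asymptotic equicontinuity contradicts pointwise convergence at their limit.
    have hex' : ∀ i, ∃ s, (∃ s ∈ Set.Icc 0 T, ε ≤ dist (shifted a x (n i) (c i) s) (φ s)) →
        s ∈ Set.Icc 0 T ∧ ε ≤ dist (shifted a x (n i) (c i) s) (φ s) := by
      intro i
      by_cases h' : ∃ s ∈ Set.Icc 0 T, ε ≤ dist (shifted a x (n i) (c i) s) (φ s)
      · exact ⟨h'.choose, fun _ => h'.choose_spec⟩
      · exact ⟨0, fun h => absurd h h'⟩
    choose σ hσ using hex'
    obtain ⟨s, hs, hsU⟩ := (isCompact_Icc (a := (0 : ℝ)) (b := T)).ultrafilter_le_nhds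
      (U.map σ) (by
        rw [le_principal_iff, Ultrafilter.coe_map, mem_map]
        filter_upwards [hcon] with i hi using (hσ i hi).1)
    have hdist : ∀ᶠ i in (U : Filter ι), L * dist (σ i) s < ε / 4 := by
      have h1 : Tendsto σ U (𝓝 s) := hsU
      have h2 : Tendsto (fun i => L * dist (σ i) s) U (𝓝 (L * dist s s)) :=
        (h1.dist tendsto_const_nhds).const_mul _
      rw [dist_self, mul_zero] at h2
      exact h2.eventually_lt_const (by positivity)
    obtain ⟨i, hi, hi1, hi2, hi3⟩ := (hcon.and (hdist.and ((hL (ε / 4) (by positivity)).and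
      (Metric.tendsto_nhds.1 (hφ s hs.1) (ε / 4) (by positivity))))).exists
    obtain ⟨hi4, hi5⟩ := hσ i hi
    have h1 := hi2 _ hi4 s hs
    have h2 := hLφ.dist_le_mul _ hi4 s hs
    have h3 := dist_triangle4 (shifted a x (n i) (c i) (σ i)) (shifted a x (n i) (c i) s) (φ s)
      (φ (σ i))
    rw [dist_comm (φ s)] at h3
    linarith

end IsNoisyPath

end Limit

/-! ### Upper semicontinuity and convexity of the fields -/

section Semicontinuity

variable {d : ℕ} {h : State d → Set (State d)}

lemma rescale_one (z : State d) : rescale h 1 z = h z := by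
  ext w; simp [rescale]

/-- A Marchaud map is upper semicontinuous. -/
theorem IsMarchaud.upperSemicontinuous (A1 : IsMarchaud h) (z : State d) {ε : ℝ} (hε : 0 < ε) :
    ∃ δ : ℝ, 0 < δ ∧ ∀ u ∈ Metric.ball z δ, h u ⊆ Metric.cthickening ε (h z) := by
  obtain ⟨K, hK, hg⟩ := A1.growth
  by_contra! hcon
  have hex : ∀ n : ℕ, ∃ u ∈ Metric.ball z (1 / ((n : ℝ) + 1)), ∃ v ∈ h u,
      v ∉ Metric.cthickening ε (h z) := fun n =>
    (hcon _ Nat.one_div_pos_of_nat).imp fun _ hu => ⟨hu.1, Set.not_subset.1 hu.2⟩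
  choose u hu v hv hvn using hex
  have hlim : Tendsto u atTop (𝓝 z) := tendsto_iff_dist_tendsto_zero.2
    (squeeze_zero (fun _ => dist_nonneg) (fun n => (Metric.mem_ball.1 (hu n)).le)
      tendsto_one_div_add_atTop_nhds_zero_nat)
  have hub : ∀ n, ‖u n‖ ≤ ‖z‖ + 1 := fun n => by
    have h1 := (Metric.mem_ball.1 (hu n)).le
    have h2 : 1 / ((n : ℝ) + 1) ≤ 1 := (div_le_one (by positivity)).2 (by simp)
    have h3 := norm_le_norm_add_norm_sub' (u n) z
    rw [dist_eq_norm] at h1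
    linarith
  have hvb : ∀ n, v n ∈ Metric.closedBall (0 : State d) (K * (1 + (‖z‖ + 1))) := fun n => by
    rw [mem_closedBall_zero_iff]
    exact (hg _ _ (hv n)).le.trans (by gcongr; exact hub n)
  obtain ⟨w, -, ψ, hψ, hw⟩ := tendsto_subseq_of_bounded Metric.isBounded_closedBall hvb
  have hmem : w ∈ h z := A1.closed_graph.mem_of_tendsto
    ((hlim.comp hψ.tendsto_atTop).prodMk_nhds hw) (Eventually.of_forall fun n => hv (ψ n))
  obtain ⟨n, hn⟩ := (hw.eventually (Metric.closedBall_mem_nhds w hε)).exists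
  exact hvn _ (Metric.mem_cthickening_of_dist_le _ w _ _ hmem hn)

/-- The rescaled maps are upper semicontinuous towards `h_∞` along integer scales. -/
theorem InfinityClosed.upperSemicontinuous (A5 : InfinityClosed h)
    (hg : ∃ K : ℝ, 0 < K ∧ ∀ x, ∀ w ∈ h x, ‖w‖ < K * (1 + ‖x‖)) (z : State d) {ε : ℝ}
    (hε : 0 < ε) :
    ∃ δ : ℝ, 0 < δ ∧ ∃ C : ℕ, ∀ c : ℕ, C ≤ c → ∀ u ∈ Metric.ball z δ,
      rescale h (c : ℝ) u ⊆ Metric.cthickening ε (hInf h z) := by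
  obtain ⟨K, hK, hg⟩ := hg
  by_contra! hcon
  have hex : ∀ n : ℕ, ∃ c : ℕ, n + 1 ≤ c ∧ ∃ u ∈ Metric.ball z (1 / ((n : ℝ) + 1)),
      ∃ v ∈ rescale h (c : ℝ) u, v ∉ Metric.cthickening ε (hInf h z) := fun n =>
    (hcon _ Nat.one_div_pos_of_nat (n + 1)).imp fun _ hc =>
      ⟨hc.1, hc.2.imp fun _ hu => ⟨hu.1, Set.not_subset.1 hu.2⟩⟩
  choose c hc u hu v hv hvn using hex
  have hlim : Tendsto u atTop (𝓝 z) := tendsto_iff_dist_tendsto_zero.2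
    (squeeze_zero (fun _ => dist_nonneg) (fun n => (Metric.mem_ball.1 (hu n)).le)
      tendsto_one_div_add_atTop_nhds_zero_nat)
  have hub : ∀ n, ‖u n‖ ≤ ‖z‖ + 1 := fun n => by
    have h1 := (Metric.mem_ball.1 (hu n)).le
    have h2 : 1 / ((n : ℝ) + 1) ≤ 1 := (div_le_one (by positivity)).2 (by simp)
    have h3 := norm_le_norm_add_norm_sub' (u n) z
    rw [dist_eq_norm] at h1
    linarith
  have hvb : ∀ n, v n ∈ Metric.closedBall (0 : State d) (K * (1 + (‖z‖ + 1))) := fun n => by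
    rw [mem_closedBall_zero_iff]
    have hc1 : (1 : ℝ) ≤ c n := by exact_mod_cast (Nat.le_add_left 1 n).trans (hc n)
    have hc0 : (0 : ℝ) < c n := one_pos.trans_le hc1
    have h1 := (hg _ _ (hv n)).le
    rw [norm_smul, norm_smul, Real.norm_of_nonneg hc0.le] at h1
    have h2 : K * (1 + c n * ‖u n‖) ≤ c n * (K * (1 + (‖z‖ + 1))) := by
      calc K * (1 + c n * ‖u n‖) ≤ K * (c n + c n * (‖z‖ + 1)) := by
            gcongr; exact hub n
        _ = c n * (K * (1 + (‖z‖ + 1))) := by ring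
    exact le_of_mul_le_mul_left (h1.trans h2) hc0
  have hctop : Tendsto c atTop atTop :=
    tendsto_atTop_mono (fun n => (Nat.le_succ n).trans (hc n)) tendsto_id
  -- `InfinityClosed` requires strictly increasing scales, hence a subsequence before the one from
  -- compactness.
  obtain ⟨θ, hθ, hcθ⟩ := strictMono_subseq_of_tendsto_atTop hctop
  obtain ⟨w, -, ψ, hψ, hw⟩ :=
    tendsto_subseq_of_bounded Metric.isBounded_closedBall fun n => hvb (θ n)
  have hmem : w ∈ hInf h z := A5 (fun n => c (θ (ψ n))) (fun n => u (θ (ψ n)))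
    (fun n => v (θ (ψ n))) z w (hcθ.comp hψ) (fun n => (Nat.le_add_left 1 _).trans (hc _))
    (hlim.comp (hθ.comp hψ).tendsto_atTop) hw fun n => hv _
  obtain ⟨n, hn⟩ := (hw.eventually (Metric.closedBall_mem_nhds w hε)).exists
  exact hvn _ (Metric.mem_cthickening_of_dist_le _ w _ _ hmem hn)

lemma isClosed_hInf (z : State d) : IsClosed (hInf h z) := isClosed_closure

/-- Two points are approximated inside the same `S c`, and the convex combination of the
approximants stays there. Empty `S c` cause no trouble, since finite distance provides the
approximants. -/
lemma convex_lowerLimit {S : ℝ → Set (State d)} (hS : ∀ c, Convex ℝ (S c)) :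
    Convex ℝ (lowerLimit S) := by
  intro p hp q hq α β hα hβ hαβ
  have hp' : Tendsto (fun c : ℝ => Metric.infEDist p (S c)) atTop (𝓝 0) := hp
  have hq' : Tendsto (fun c : ℝ => Metric.infEDist q (S c)) atTop (𝓝 0) := hq
  change Tendsto (fun c : ℝ => Metric.infEDist (α • p + β • q) (S c)) atTop (𝓝 0)
  rw [ENNReal.tendsto_nhds_zero] at hp' hq' ⊢
  intro ε hε
  rcases eq_or_ne ε ⊤ with rfl | hεt
  · simp
  have hε2 : 0 < ε.toReal := ENNReal.toReal_pos hε.ne' hεt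
  have hof : ENNReal.ofReal ε.toReal = ε := ENNReal.ofReal_toReal hεt
  filter_upwards [hp' (ENNReal.ofReal (ε.toReal / 2)) (ENNReal.ofReal_pos.2 (by positivity)),
    hq' (ENNReal.ofReal (ε.toReal / 2)) (ENNReal.ofReal_pos.2 (by positivity))] with c hpc hqc
  have hlt : ENNReal.ofReal (ε.toReal / 2) < ENNReal.ofReal ε.toReal :=
    (ENNReal.ofReal_lt_ofReal_iff hε2).2 (by linarith)
  obtain ⟨p', hp'S, hpp'⟩ := Metric.infEDist_lt_iff.1 (hpc.trans_lt hlt)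
  obtain ⟨q', hq'S, hqq'⟩ := Metric.infEDist_lt_iff.1 (hqc.trans_lt hlt)
  refine (Metric.infEDist_le_edist_of_mem (hS c hp'S hq'S hα hβ hαβ)).trans ?_
  rw [edist_dist, ENNReal.ofReal_lt_ofReal_iff hε2] at hpp' hqq'
  rw [edist_dist, ← hof]
  refine ENNReal.ofReal_le_ofReal ?_
  rw [dist_eq_norm] at hpp' hqq' ⊢
  have : α • p + β • q - (α • p' + β • q') = α • (p - p') + β • (q - q') := by
    rw [smul_sub, smul_sub]; abel
  rw [this]
  refine (norm_add_le _ _).trans ?_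
  rw [norm_smul, norm_smul, Real.norm_of_nonneg hα, Real.norm_of_nonneg hβ]
  calc α * ‖p - p'‖ + β * ‖q - q'‖ ≤ α * ε.toReal + β * ε.toReal := by gcongr
    _ = ε.toReal := by rw [← add_mul, hαβ, one_mul]

lemma convex_hInf (hconv : ∀ z, Convex ℝ (h z)) (z : State d) : Convex ℝ (hInf h z) := by
  refine (convex_lowerLimit fun c => ?_).closure
  exact (hconv (c • z)).affine_preimage ((LinearMap.lsmul ℝ (State d) c).toAffineMap)

end Semicontinuity

/-! ### Boundedness of the path -/

section Path

variable {d : ℕ} {h : State d → Set (State d)} {a : ℕ → ℝ} {x y m : ℕ → State d}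

/-- Solutions of the limiting inclusion that start in the unit ball end up, uniformly, in a
smaller ball. -/
lemma InfinityAttracting.exists_contraction (A4 : InfinityAttracting h) :
    ∃ ρ < (1 : ℝ), ∃ T : ℝ, 1 ≤ T ∧ ∀ φ, IsSolution (hInf h) φ → ‖φ 0‖ ≤ 1 → ‖φ T‖ ≤ ρ := by
  obtain ⟨A, U, hA, hU, hAb⟩ := A4.attracting
  -- A compact set in the open ball has a closed thickening there, and that thickening already lies
  -- in a strictly smaller ball.
  obtain ⟨δ, hδ, hδA⟩ := hA.compact.exists_cthickening_subset_open Metric.isOpen_ball hAb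
  obtain ⟨ρ, hρ, hρA⟩ := exists_pos_lt_subset_ball one_pos Metric.isClosed_cthickening hδA
  obtain ⟨T, -, hT⟩ := hA.attracts δ hδ
  refine ⟨ρ, hρ.2, max T 1, le_max_right _ _, fun φ hφ h0 => ?_⟩
  have hmem : φ (max T 1) ∈ flowImage (hInf h) (Set.Ici T) U := by
    refine Set.mem_iUnion₂.2 ⟨max T 1, Set.mem_Ici.2 (le_max_left _ _), Set.mem_iUnion₂.2 ⟨φ 0, hU ?_, ?_⟩⟩
    · exact mem_closedBall_zero_iff.2 h0
    · exact ⟨φ, hφ, rfl, rfl⟩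
  have := hρA (Metric.thickening_subset_cthickening _ _ (hT hmem))
  exact (mem_ball_zero_iff.1 this).le

namespace IsNoisyPath

/-- Far from the origin, the path does not move outwards over a suitable time window. -/
lemma exists_norm_clockIndex_le (hp : IsNoisyPath h a x y m) (A1 : IsMarchaud h)
    (A2 : StepSizes a) (A4 : InfinityAttracting h) (A5 : InfinityClosed h) :
    ∃ T : ℝ, 1 ≤ T ∧ ∃ N : ℕ, ∀ n, N ≤ n → (N : ℝ) + 1 ≤ ‖x n‖ →
      ‖x (clockIndex a (clock a n + T))‖ ≤ ‖x n‖ := by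
  obtain ⟨ρ, hρ, T, hT, hφ⟩ := A4.exists_contraction
  refine ⟨T, hT, ?_⟩
  by_contra! hcon
  choose n hn hnx hnT using hcon
  obtain ⟨K, hK, hg⟩ := A1.growth
  -- Scales are rounded up because semicontinuity towards `hInf h` holds only along integers.
  -- Rounding loses less than `1`, hence the lower bound `1 - 1 / c i` at time `T`, which tends to
  -- `1`.
  set c : ℕ → ℕ := fun i => ⌈‖x (n i)‖⌉₊ with hc
  have hcx : ∀ i, ‖x (n i)‖ ≤ c i := fun i => Nat.le_ceil _
  have hci : ∀ i : ℕ, (i : ℝ) + 1 ≤ c i := fun i => (hnx i).trans (hcx i)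
  have hc1 : ∀ i, (1 : ℝ) ≤ c i := fun i => by
    have := hci i
    have : (0 : ℝ) ≤ i := Nat.cast_nonneg i
    linarith
  set U : Ultrafilter ℕ := hyperfilter ℕ
  have hU : (U : Filter ℕ) ≤ atTop := Nat.hyperfilter_le_atTop
  have hnU : Tendsto n U atTop := (tendsto_atTop_mono hn tendsto_id).mono_left hU
  have hcU : Tendsto c U atTop := by
    refine (tendsto_atTop_mono (fun i => ?_) tendsto_id).mono_left hU
    have : (i : ℝ) ≤ c i := by linarith [hci i]
    exact_mod_cast this
  have hbd : BoundedWindows a x U n fun i => (c i : ℝ) := by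
    intro S
    obtain ⟨C, hC1, hC⟩ := hp.eventually_norm_le A2 hK hg S
    refine ⟨C, hC1, ?_⟩
    filter_upwards [hnU.eventually hC] with i hi k hk hkS
    exact (hi k hk hkS).trans
      (mul_le_mul_of_nonneg_left (max_le (hc1 i) (hcx i)) (by positivity))
  obtain ⟨φ, hsol, hlim, -⟩ := hp.exists_limit_solution A2 hnU hc1 hbd A1.growth
    (fun z => isClosed_hInf z) (convex_hInf A1.convex) fun z ε hε => by
      obtain ⟨δ, hδ, C, hC⟩ := A5.upperSemicontinuous A1.growth z hε
      refine ⟨δ, hδ, ?_⟩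
      filter_upwards [hcU.eventually_ge_atTop C] with i hi using hC _ hi
  have h0 : ‖φ 0‖ ≤ 1 := by
    refine le_of_tendsto (hlim 0 le_rfl).norm (Eventually.of_forall fun i => ?_)
    have hpos : (0 : ℝ) < c i := one_pos.trans_le (hc1 i)
    rw [shifted, add_zero, A2.clockIndex_clock, norm_smul, norm_inv, Real.norm_of_nonneg hpos.le,
      inv_mul_le_iff₀ hpos, mul_one]
    exact hcx i
  have h1 : 1 ≤ ‖φ T‖ := by
    have hl : Tendsto (fun i : ℕ => 1 - 1 / ((i : ℝ) + 1)) U (𝓝 (1 - 0)) :=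
      (tendsto_const_nhds.sub tendsto_one_div_add_atTop_nhds_zero_nat).mono_left hU
    rw [sub_zero] at hl
    refine le_of_tendsto_of_tendsto hl (hlim T (by linarith)).norm
      (Eventually.of_forall fun i => ?_)
    have hpos : (0 : ℝ) < c i := one_pos.trans_le (hc1 i)
    change 1 - 1 / ((i : ℝ) + 1) ≤ ‖shifted a x (n i) (c i) T‖
    rw [shifted, norm_smul, norm_inv, Real.norm_of_nonneg hpos.le]
    have h2 : (c i : ℝ) < ‖x (n i)‖ + 1 := Nat.ceil_lt_add_one (norm_nonneg _)
    have h3 : 1 / (c i : ℝ) ≤ 1 / ((i : ℝ) + 1) :=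
      one_div_le_one_div_of_le (by positivity) (hci i)
    calc 1 - 1 / ((i : ℝ) + 1) ≤ 1 - 1 / (c i : ℝ) := by linarith
      _ = (c i : ℝ)⁻¹ * (c i - 1) := by field_simp
      _ ≤ (c i : ℝ)⁻¹ * ‖x (clockIndex a (clock a (n i) + T))‖ := by
        gcongr; linarith [hnT i]
  linarith [hφ φ hsol h0]

/-- The path is bounded. -/
theorem exists_norm_le (hp : IsNoisyPath h a x y m) (A1 : IsMarchaud h)
    (A2 : StepSizes a) (A4 : InfinityAttracting h) (A5 : InfinityClosed h) :
    ∃ B : ℝ, ∀ n, ‖x n‖ ≤ B := by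
  obtain ⟨T, hT, N, hN⟩ := hp.exists_norm_clockIndex_le A1 A2 A4 A5
  obtain ⟨K, hK, hg⟩ := A1.growth
  obtain ⟨C, hC1, hC⟩ := hp.eventually_norm_le A2 hK hg (T + 1)
  obtain ⟨n₀, hn₀⟩ := eventually_atTop.1
    (hC.and ((A2.eventually_clock_clockIndex_lt one_pos).and (eventually_ge_atTop N)))
  set B : ℝ := max ‖x n₀‖ (C * (N + 1)) with hB
  have hjump : ∀ n, n₀ ≤ n → ‖x n‖ ≤ B → ‖x (clockIndex a (clock a n + T))‖ ≤ B := by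
    intro n hn hnB
    obtain ⟨h1, h2, h3⟩ := hn₀ n hn
    rcases le_total ((N : ℝ) + 1) ‖x n‖ with hle | hle
    · exact (hN n h3 hle).trans hnB
    · refine le_trans ?_ (le_max_right _ _)
      refine (h1 _ (A2.le_clockIndex_add n (by linarith))
        (by linarith [h2 T (by linarith)])).trans ?_
      exact mul_le_mul_of_nonneg_left (max_le (by linarith [N.cast_nonneg (α := ℝ)]) hle)
        (by linarith)
  -- Checkpoints of norm at most `B` occur less than `T` before every iterate: when the window of
  -- one closes at `k + 1`, that iterate is the next, by `hjump`.
  have hcover : ∀ k, n₀ ≤ k → ∃ n, n₀ ≤ n ∧ n ≤ k ∧ ‖x n‖ ≤ B ∧ clock a k < clock a n + T := by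
    intro k hk
    induction k, hk using Nat.le_induction with
    | base => exact ⟨n₀, le_rfl, le_rfl, le_max_left _ _, by linarith⟩
    | succ k hk ih =>
      obtain ⟨n, hn, hnk, hnB, hkn⟩ := ih
      rcases lt_or_ge (clock a (k + 1)) (clock a n + T) with hlt | hge
      · exact ⟨n, hn, by omega, hnB, hlt⟩
      · have hidx : clockIndex a (clock a n + T) = k + 1 := by
          refine le_antisymm (clockIndex_le hge) (Nat.succ_le_of_lt ?_)
          exact A2.clock_strictMono.lt_iff_lt.1 (hkn.trans_le (A2.le_clock_clockIndex _))
        refine ⟨k + 1, by omega, le_rfl, ?_, by linarith⟩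
        rw [← hidx]
        exact hjump n hn hnB
  have hbdd : IsBoundedUnder (· ≤ ·) atTop fun k => ‖x k‖ := by
    refine isBoundedUnder_of_eventually_le (a := C * max 1 B) ?_
    filter_upwards [eventually_ge_atTop n₀] with k hk
    obtain ⟨n, hn, hnk, hnB, hkn⟩ := hcover k hk
    refine ((hn₀ n hn).1 k hnk (by linarith)).trans ?_
    exact mul_le_mul_of_nonneg_left (max_le_max le_rfl hnB) (by linarith)
  obtain ⟨B', hB'⟩ := hbdd.bddAbove_range
  exact ⟨B', fun n => hB' (Set.mem_range_self n)⟩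

end IsNoisyPath

lemma IsSolution.continuousOn {H : State d → Set (State d)} {φ : ℝ → State d}
    (hφ : IsSolution H φ) {T : ℝ} (hT : 0 ≤ T) : ContinuousOn φ (Set.Icc 0 T) := by
  have := (hφ.absCont T hT).continuousOn
  rwa [Set.uIcc_of_le hT] at this

/-! ### Chains and connectedness -/

section Chain

variable {H : State d → Set (State d)} {S : Set (State d)} {ε T t : ℝ} {p p' q : State d}
  {φ : ℝ → State d}

/-- A chain with a single piece. -/
lemma HasChain.single (hφ : IsSolution H φ) (h0 : φ 0 = p) (ht : T < t)
    (hS : ∀ s ∈ Set.Icc 0 t, φ s ∈ S) (hp : p ∈ S) (hq : q ∈ S) (hd : dist (φ t) q < ε) :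
    HasChain H S ε T p q := by
  refine ⟨0, ![p, q], fun _ => φ, fun _ => t, rfl, rfl, fun i => ?_, fun i => ?_⟩
  · fin_cases i
    · exact hp
    · exact hq
  · fin_cases i
    exact ⟨hφ, h0, ht, hS, hd⟩

/-- A piece can be put in front of a chain. -/
lemma HasChain.cons (hφ : IsSolution H φ) (h0 : φ 0 = p) (ht : T < t)
    (hS : ∀ s ∈ Set.Icc 0 t, φ s ∈ S) (hp : p ∈ S) (hd : dist (φ t) p' < ε)
    (hc : HasChain H S ε T p' q) : HasChain H S ε T p q := by
  obtain ⟨n, r, ψ, τ, hr0, hr1, hrS, hψ⟩ := hc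
  refine ⟨n + 1, Fin.cons p r, Fin.cons φ ψ, Fin.cons t τ, rfl, ?_, fun i => ?_, fun i => ?_⟩
  · rw [← Fin.succ_last, Fin.cons_succ, hr1]
  · refine Fin.cases ?_ (fun j => ?_) i
    · exact hp
    · rw [Fin.cons_succ]; exact hrS j
  · refine Fin.cases ?_ (fun j => ?_) i
    · refine ⟨hφ, h0, ht, hS, ?_⟩
      rw [Fin.cons_zero, Fin.cons_zero, Fin.cons_succ, hr0]
      exact hd
    · rw [← Fin.succ_castSucc, Fin.cons_succ, Fin.cons_succ, Fin.cons_succ, Fin.cons_succ]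
      exact hψ j

/-- Internally chain transitive sets are connected. -/
theorem IsInternallyChainTransitive.isPreconnected (hS : IsInternallyChainTransitive H S) :
    IsPreconnected S := by
  rw [isPreconnected_closed_iff]
  intro A B hA hB hAB ⟨p, hpS, hpA⟩ ⟨q, hqS, hqB⟩
  by_contra hempty
  have hdisj : Disjoint (S ∩ A) (S ∩ B) := by
    refine Set.disjoint_left.2 fun z hz hz' => hempty ⟨z, hz.1, hz.2, hz'.2⟩
  obtain ⟨δ, hδ, hthick⟩ := hdisj.exists_thickenings (hS.1.inter_right hA)
    (hS.1.isClosed.inter hB)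
  have hsplit : ∀ z ∈ S, z ∈ Metric.thickening δ (S ∩ A) → z ∈ S ∩ A := by
    intro z hz hzA
    rcases hAB hz with h | h
    · exact ⟨hz, h⟩
    · have hzB : z ∈ S ∩ B := ⟨hz, h⟩
      exact absurd (Metric.self_subset_thickening hδ _ hzB) (Set.disjoint_left.1 hthick hzA)
  obtain ⟨n, r, ψ, τ, hr0, hr1, hrS, hψ⟩ := hS.2 p hpS q hqS δ hδ 1 one_pos
  -- A chain cannot leave `S ∩ A`: solution pieces are connected and jumps are shorter than `δ`,
  -- while the thickenings are disjoint.
  have hind : ∀ i : Fin (n + 2), r i ∈ S ∩ A := by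
    intro i
    induction i using Fin.induction with
    | zero => rw [hr0]; exact ⟨hpS, hpA⟩
    | succ i ih =>
      obtain ⟨hsol, h0, hτ, hin, hdist⟩ := hψ i
      have hτ0 : 0 ≤ τ i := by linarith
      have hpre : IsPreconnected (ψ i '' Set.Icc 0 (τ i)) :=
        isPreconnected_Icc.image _ (hsol.continuousOn hτ0)
      have hsub : ψ i '' Set.Icc 0 (τ i) ⊆ Metric.thickening δ (S ∩ A) := by
        refine hpre.subset_left_of_subset_union Metric.isOpen_thickening
          Metric.isOpen_thickening hthick ?_ ⟨ψ i 0, ⟨0, ⟨le_rfl, hτ0⟩, rfl⟩, ?_⟩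
        · rintro _ ⟨s, hs, rfl⟩
          have hz := hin s hs
          exact (hAB hz).imp (fun h => Metric.self_subset_thickening hδ _ ⟨hz, h⟩)
            fun h => Metric.self_subset_thickening hδ _ ⟨hz, h⟩
        · rw [h0]; exact Metric.self_subset_thickening hδ _ ih
      have hend : ψ i (τ i) ∈ S ∩ A :=
        hsplit _ (hin _ ⟨hτ0, le_rfl⟩) (hsub ⟨τ i, ⟨hτ0, le_rfl⟩, rfl⟩)
      refine hsplit _ (hrS _) (Metric.mem_thickening_iff.2 ⟨_, hend, ?_⟩)
      rwa [dist_comm]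
  have hlast := hind (Fin.last (n + 1))
  rw [hr1] at hlast
  exact hempty ⟨q, hqS, hlast.2, hqB⟩

end Chain

/-! ### The limit set of a bounded path -/

/-- The limit set of a sequence. -/
def limitSet (x : ℕ → State d) : Set (State d) := {p | MapClusterPt p atTop x}

namespace IsNoisyPath

/-- Along an ultrafilter the shifts of a bounded path converge to a solution in its limit set. -/
lemma exists_limit_in_limitSet (hp : IsNoisyPath h a x y m) (A1 : IsMarchaud h)
    (A2 : StepSizes a) {B : ℝ} (hB : ∀ n, ‖x n‖ ≤ B) {U : Ultrafilter ℕ} {n : ℕ → ℕ}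
    (hn : Tendsto n U atTop) :
    ∃ φ : ℝ → State d, IsSolution h φ ∧ (∀ s, 0 ≤ s → φ s ∈ limitSet x) ∧
      Tendsto (fun i => x (n i)) U (𝓝 (φ 0)) ∧
      ∀ T ε : ℝ, 0 < ε → ∀ᶠ i in (U : Filter ℕ), ∀ s ∈ Set.Icc 0 T,
        dist (x (clockIndex a (clock a (n i) + s))) (φ s) < ε := by
  obtain ⟨φ, hsol, hlim, hunif⟩ := hp.exists_limit_solution A2 hn (c := fun _ => 1)
    (fun _ => le_rfl)
    (fun T => ⟨max 1 B, le_max_left _ _, Eventually.of_forall fun i k _ _ => by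
      rw [mul_one]; exact (hB k).trans (le_max_right _ _)⟩)
    A1.growth (fun z => (A1.compact z).isClosed) A1.convex fun z ε hε => by
      obtain ⟨δ, hδ, hδh⟩ := A1.upperSemicontinuous z hε
      exact ⟨δ, hδ, Eventually.of_forall fun i u hu => by rw [rescale_one]; exact hδh u hu⟩
  simp only [shifted, inv_one, one_smul] at hlim hunif
  refine ⟨φ, hsol, fun s hs => ?_, ?_, hunif⟩
  · have hidx : Tendsto (fun i => clockIndex a (clock a (n i) + s)) U atTop :=
      tendsto_atTop_mono (fun i => A2.le_clockIndex_add (n i) hs) hn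
    exact MapClusterPt.of_comp hidx (hlim s hs).mapClusterPt
  · simpa [A2.clockIndex_clock] using hlim 0 le_rfl

/-- Through every point of the limit set passes a solution in the limit set that is shadowed by
arbitrarily late pieces of the path. -/
lemma exists_solution_through (hp : IsNoisyPath h a x y m) (A1 : IsMarchaud h)
    (A2 : StepSizes a) {B : ℝ} (hB : ∀ n, ‖x n‖ ≤ B) {p : State d} (hpS : p ∈ limitSet x) :
    ∃ φ : ℝ → State d, IsSolution h φ ∧ φ 0 = p ∧ (∀ s, 0 ≤ s → φ s ∈ limitSet x) ∧
      ∀ T ε : ℝ, 0 < ε → ∃ᶠ n in atTop, ∀ s ∈ Set.Icc 0 T,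
        dist (x (clockIndex a (clock a n + s))) (φ s) < ε := by
  obtain ⟨U, hU, hUp⟩ := mapClusterPt_iff_ultrafilter.1 hpS
  obtain ⟨φ, hsol, hS, h0, hunif⟩ := hp.exists_limit_in_limitSet A1 A2 hB (n := id) hU
  exact ⟨φ, hsol, tendsto_nhds_unique h0 hUp, hS, fun T ε hε =>
    (hunif T ε hε).frequently.filter_mono hU⟩

/-- Late pieces of the path are shadowed by solutions in the limit set. -/
lemma eventually_exists_shadow (hp : IsNoisyPath h a x y m) (A1 : IsMarchaud h)
    (A2 : StepSizes a) {B : ℝ} (hB : ∀ n, ‖x n‖ ≤ B) (T : ℝ) {ε : ℝ} (hε : 0 < ε) :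
    ∀ᶠ n in atTop, ∃ φ : ℝ → State d, IsSolution h φ ∧ (∀ s, 0 ≤ s → φ s ∈ limitSet x) ∧
      ∀ s ∈ Set.Icc 0 T, dist (x (clockIndex a (clock a n + s))) (φ s) < ε := by
  by_contra hcon
  rw [not_eventually] at hcon
  obtain ⟨n, hn, hnot⟩ := extraction_of_frequently_atTop hcon
  have hU : Tendsto n (hyperfilter ℕ) atTop :=
    hn.tendsto_atTop.mono_left Nat.hyperfilter_le_atTop
  obtain ⟨φ, hsol, hS, -, hunif⟩ := hp.exists_limit_in_limitSet A1 A2 hB hU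
  obtain ⟨i, hi⟩ := (hunif T ε hε).exists
  exact hnot i ⟨φ, hsol, hS, hi⟩

/-- The limit set of a bounded path is internally chain transitive. -/
theorem isInternallyChainTransitive_limitSet (hp : IsNoisyPath h a x y m) (A1 : IsMarchaud h)
    (A2 : StepSizes a) {B : ℝ} (hB : ∀ n, ‖x n‖ ≤ B) :
    IsInternallyChainTransitive h (limitSet x) := by
  refine ⟨?_, fun p hpS q hqS ε hε T hT => ?_⟩
  · refine (isCompact_closedBall (0 : State d) B).of_isClosed_subset isClosed_setOfPred_clusterPt ?_
    intro p hpS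
    exact Metric.isClosed_closedBall.mem_of_mapClusterPt hpS
      (Eventually.of_forall fun n => mem_closedBall_zero_iff.2 (hB n))
  have hε3 : 0 < ε / 3 := by positivity
  obtain ⟨N, hN⟩ := eventually_atTop.1 ((hp.eventually_exists_shadow A1 A2 hB (2 * T + 3) hε3).and
    (A2.eventually_clock_clockIndex_lt one_pos))
  -- Induction on the number of iterates left. Within time `2 * T + 3` one piece suffices; otherwise
  -- a piece of length between `T + 1` and `T + 2` leaves at least `T + 1`, enough for another. The
  -- shadowing solutions start wherever they must, so the initial point `p'` is free.
  have hchain : ∀ n', dist (x n') q < ε / 3 → ∀ j n, n' - n ≤ j → N ≤ n →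
      clock a n + T < clock a n' →
      ∃ p', dist (x n) p' < ε / 3 ∧ HasChain h (limitSet x) ε T p' q := by
    intro n' hn' j
    induction j with
    | zero =>
      intro n hj _ hclock
      have := A2.clock_strictMono.monotone (by omega : n' ≤ n)
      linarith
    | succ j ih =>
      intro n hj hn hclock
      obtain ⟨⟨φ, hsol, hS, hshadow⟩, hover⟩ := hN n hn
      have hstart : dist (x n) (φ 0) < ε / 3 := by
        simpa [A2.clockIndex_clock] using hshadow 0 ⟨le_rfl, by linarith⟩
      refine ⟨φ 0, hstart, ?_⟩
      have hpiece : ∀ k, clock a k - clock a n ∈ Set.Icc 0 (2 * T + 3) →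
          dist (x k) (φ (clock a k - clock a n)) < ε / 3 := by
        intro k hk
        simpa [A2.clockIndex_clock] using hshadow _ hk
      rcases le_total (clock a n') (clock a n + (2 * T + 3)) with hle | hge
      · have h1 := hpiece n' ⟨by linarith, by linarith⟩
        refine HasChain.single hsol rfl (by linarith) (fun s hs => hS s hs.1) (hS 0 le_rfl) hqS
          (t := clock a n' - clock a n) ?_
        have := dist_triangle_left (φ (clock a n' - clock a n)) q (x n')
        linarith
      · set n₁ := clockIndex a (clock a n + (T + 1)) with hn₁
        have h2 : clock a n₁ < clock a n + (T + 1) + 1 := hover (T + 1) (by linarith)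
        have h3 : clock a n + (T + 1) ≤ clock a n₁ := A2.le_clock_clockIndex _
        have h4 : n < n₁ := A2.clock_strictMono.lt_iff_lt.1 (by linarith)
        have h5 : n < n' := A2.clock_strictMono.lt_iff_lt.1 (by linarith)
        obtain ⟨p', hp', hc⟩ := ih n₁ (by omega) (by omega) (by linarith)
        have h1 := hpiece n₁ ⟨by linarith, by linarith⟩
        refine HasChain.cons hsol rfl (by linarith) (fun s hs => hS s hs.1) (hS 0 le_rfl)
          (t := clock a n₁ - clock a n) ?_ hc
        have := dist_triangle_left (φ (clock a n₁ - clock a n)) p' (x n₁)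
        linarith
  -- Only the first piece must start exactly at a prescribed point, so it follows a solution through
  -- `p` that late pieces of the path shadow.
  obtain ⟨φ, hsol, h0, hS, hfreq⟩ := hp.exists_solution_through A1 A2 hB hpS
  obtain ⟨n, hnear, hn⟩ := ((hfreq (T + 2) (ε / 3) hε3).and_eventually
    (eventually_ge_atTop N)).exists
  set n₁ := clockIndex a (clock a n + (T + 1)) with hn₁
  have h2 : clock a n₁ < clock a n + (T + 1) + 1 := (hN n hn).2 (T + 1) (by linarith)
  have h3 : clock a n + (T + 1) ≤ clock a n₁ := A2.le_clock_clockIndex _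
  have h4 : n < n₁ := A2.clock_strictMono.lt_iff_lt.1 (by linarith)
  have h1 : dist (x n₁) (φ (clock a n₁ - clock a n)) < ε / 3 := by
    simpa [A2.clockIndex_clock] using
      hnear (clock a n₁ - clock a n) ⟨by linarith, by linarith⟩
  have hqfreq : ∃ᶠ k in atTop, dist (x k) q < ε / 3 :=
    (mapClusterPt_iff_frequently.1 hqS) _ (Metric.ball_mem_nhds q hε3)
  have hlarge : ∀ᶠ k in atTop, clock a n₁ + T < clock a k :=
    A2.sum_diverges.eventually_gt_atTop _
  obtain ⟨n', hn'q, hn'⟩ := (hqfreq.and_eventually hlarge).exists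
  obtain ⟨p', hp', hc⟩ := hchain n' hn'q (n' - n₁) n₁ le_rfl (by omega) hn'
  refine HasChain.cons hsol h0 (by linarith) (fun s hs => hS s hs.1) hpS
    (t := clock a n₁ - clock a n) ?_ hc
  have := dist_triangle_left (φ (clock a n₁ - clock a n)) p' (x n₁)
  linarith

/-- The path approaches its limit set, which has all the required properties. -/
theorem limitSet_spec (hp : IsNoisyPath h a x y m) (A1 : IsMarchaud h)
    (A2 : StepSizes a) {B : ℝ} (hB : ∀ n, ‖x n‖ ≤ B) :
    IsClosed (limitSet x) ∧ IsConnected (limitSet x) ∧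
      IsInternallyChainTransitive h (limitSet x) ∧ IsInvariant h (limitSet x) ∧
      Tendsto (fun n => Metric.infDist (x n) (limitSet x)) atTop (𝓝 0) := by
  have hict := hp.isInternallyChainTransitive_limitSet A1 A2 hB
  obtain ⟨p, -, hpS⟩ := (isCompact_closedBall (0 : State d) B).exists_mapClusterPt
    (f := atTop) (u := x)
    (tendsto_principal.2 (Eventually.of_forall fun n => mem_closedBall_zero_iff.2 (hB n)))
  refine ⟨hict.1.isClosed, ⟨⟨p, hpS⟩, hict.isPreconnected⟩, hict, fun p hp' => ?_, ?_⟩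
  · obtain ⟨φ, hsol, h0, hS, -⟩ := hp.exists_solution_through A1 A2 hB hp'
    exact ⟨φ, hsol, h0, hS⟩
  · rw [Metric.tendsto_nhds]
    intro ε hε
    filter_upwards [hp.eventually_exists_shadow A1 A2 hB 0 hε] with n hn
    obtain ⟨φ, -, hS, hshadow⟩ := hn
    have h1 : dist (x n) (φ 0) < ε := by
      simpa [A2.clockIndex_clock] using hshadow 0 ⟨le_rfl, le_rfl⟩
    rw [Real.dist_0_eq_abs, abs_of_nonneg Metric.infDist_nonneg]
    exact (Metric.infDist_le_dist_of_mem (hS 0 le_rfl)).trans_lt h1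

end IsNoisyPath

end Path

end SRI

theorem theorem2 {Ω : Type*} [MeasurableSpace Ω] (μ : Measure Ω) [IsProbabilityMeasure μ]
    {d : ℕ} (h : SRI.State d → Set (SRI.State d)) (a : ℕ → ℝ)
    (x y M : ℕ → Ω → SRI.State d)
    (hrec : ∀ n, ∀ᵐ ω ∂μ, x (n + 1) ω = x n ω + a n • (y n ω + M (n + 1) ω))
    (hy : ∀ n, ∀ᵐ ω ∂μ, y n ω ∈ h (x n ω))
    (A1 : SRI.IsMarchaud h)
    (A2 : SRI.StepSizes a)
    (A3 : SRI.MartingaleNoise μ x M)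
    (A4 : SRI.InfinityAttracting h)
    (A5 : SRI.InfinityClosed h) :
    ∀ᵐ ω ∂μ, Bornology.IsBounded (Set.range fun n => x n ω) ∧
      ∃ S : Set (SRI.State d), IsClosed S ∧ IsConnected S ∧
        SRI.IsInternallyChainTransitive h S ∧ SRI.IsInvariant h S ∧
        Tendsto (fun n => Metric.infDist (x n ω) S) atTop (𝓝 0) := by
  filter_upwards [ae_all_iff.2 hrec, ae_all_iff.2 hy, A3.ae_noiseNegligible A2.sq_summable]
    with ω h1 h2 h3
  have hp : SRI.IsNoisyPath h a (fun n => x n ω) (fun n => y n ω) (fun n => M n ω) := ⟨h1, h2, h3⟩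
  obtain ⟨B, hB⟩ := hp.exists_norm_le A1 A2 A4 A5
  refine ⟨?_, _, hp.limitSet_spec A1 A2 hB⟩
  exact isBounded_iff_forall_norm_le.2 ⟨B, Set.forall_mem_range.2 hB⟩
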